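/- Call a compact convex subset of $\mathbb{R}^3$ with non-empty interior a convex body; let $\mathrm{Vol}$ denote volume and $\mathrm{Diam}$ the Euclidean diameter. (1) For every convex body $K\subset\mathbb{R}^3$ there is a linear bijection $T:\mathbb{R}^3\to\mathbb{R}^3$ such that $$\mathrm{Vol}(TK)\ \ge\ \frac{\sqrt2}{12}\,\mathrm{Diam}(TK)^3 .$$ (2) The bound is attained by simplices: if $K$ is the convex hull of four affinely independent points of $\mathbb{R}^3$, then $\mathrm{Vol}(TK)\le\frac{\sqrt2}{12}\,\mathrm{Diam}(TK)^3$ for every linear bijection $T:\mathbb{R}^3\to\mathbb{R}^3$, with equality for some such $T$. -/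

import Mathlib

/-- A convex body in `ℝ³`: a compact convex set with non-empty interior. -/
structure IsConvexBody3 (K : Set (EuclideanSpace ℝ (Fin 3))) : Prop where
  convex : Convex ℝ K
  isCompact : IsCompact K
  interior_nonempty : (interior K).Nonempty

/-! For part (1), among the linear maps sending the difference set `K - K` into the unit ball, take
one of maximal determinant. Then `TK` has diameter at most 1, and John's theorem gives six weighted
unit vectors of `T(K - K)`, isotropic with total mass 1. If three of them satisfy `det ^ 2 ≥ 1/2`,
then `TK` contains translates of the three segments, and successive cone estimates give volume at
least `|det| / 6 ≥ √2/12` (`abs_det_div_factorial_le_volume`).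

The core is `exists_tripleDet_sq_ge`. Fix a vector `u a` of largest mass `m ≥ 1/6`. Isotropy makes
the weighted sum of `det(u a, u j, u k) ^ 2` over ordered pairs equal to `2/9`. Modulo `u a` the
other five vectors are plane vectors with masses at most `m`, and it suffices that this sum is at
most `4/9` of the largest squared determinant (`exists_planeDet_sq_ge`). Normalise the largest
determinant to 1, attained by the standard basis. The sum is convex in each vector, so two vectors
of one quadrant may be pushed to vertices of a square or pentagon. Either two vectors merge, and a
Plücker relation settles four vectors, or one pentagonal configuration remains, settled by an
inequality on a weighted five-cycle.

For part (2), Hadamard's inequality applied to the doubled bimedians of a tetrahedron bounds its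
volume by the diameter. A linear map sending the edges at one vertex to those of a regular
tetrahedron gives equality. -/

/-! ### Mass inequalities and four vectors in the plane -/

/-- The determinant of two vectors of the plane. -/
def planeDet (p q : ℝ × ℝ) : ℝ := p.1 * q.2 - p.2 * q.1

theorem planeDet_self (p : ℝ × ℝ) : planeDet p p = 0 := by
  unfold planeDet; ring

theorem planeDet_swap_sq (p q : ℝ × ℝ) : planeDet p q ^ 2 = planeDet q p ^ 2 := by
  unfold planeDet; ring

theorem planeDet_pluecker (p q r s : ℝ × ℝ) :
    planeDet p q * planeDet r s + planeDet p s * planeDet q r = planeDet p r * planeDet q s := by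
  unfold planeDet; ring

/-- Of three masses with sum `1 - m`, one of them at most `m`, where `1 / 6 ≤ m`. -/
theorem three_masses_le {m x y z : ℝ} (hm : 1 / 6 ≤ m) (hx : 0 ≤ x) (hy : 0 ≤ y) (hz : 0 ≤ z)
    (hxm : x ≤ m) (hs : x + y + z + m = 1) : x * y + x * z + y * z ≤ 2 / 9 := by
  -- For fixed `x` the worst case is `y = z`.
  have h1 : x * y + x * z + y * z ≤ (1 - m - x) * (3 * x + (1 - m)) / 4 := by
    have : z = 1 - m - x - y := by linarith
    subst this
    nlinarith [sq_nonneg (2 * y - (1 - m - x))]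
  -- The bound `h1` increases in `x` up to `(1 - m) / 3`. If `m ≤ 1/4` the extreme is `x = m`, with
  -- value `(1 - 4 * m ^ 2) / 4`, which is `2/9` at `m = 1/6`. Otherwise the free maximum `(1 - m) ^
  -- 2 / 3 ≤ 3/16` suffices.
  rcases le_total m (1 / 4) with h | h
  · nlinarith [mul_nonneg (sub_nonneg.2 hxm) (by linarith : (0 : ℝ) ≤ 1 - 4 * m + (m - x)),
      mul_nonneg (sub_nonneg.2 hm) (by linarith : (0 : ℝ) ≤ m + 1 / 6),
      mul_nonneg (sub_nonneg.2 hxm) (sub_nonneg.2 hxm)]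
  · nlinarith [sq_nonneg (3 * x - (1 - m)), mul_nonneg (sub_nonneg.2 h) (by linarith : 0 ≤ 1 - m)]

/-- Since `(1 - x²)(1 - y²) ≥ 0`, the losses of `x` and `y` add up to at least `1 - (x * y)²`;
likewise for `z` and `t`. The last hypothesis then makes the total loss at least `M`. -/
theorem four_weights_loss {α β γ δ M x y z t : ℝ} (hM : 0 ≤ M) (hα : M ≤ α) (hβ : M ≤ β)
    (hγ : M ≤ γ) (hδ : M ≤ δ) (hx : x ^ 2 ≤ 1) (hy : y ^ 2 ≤ 1) (hz : z ^ 2 ≤ 1) (ht : t ^ 2 ≤ 1)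
    (h : (x * y) ^ 2 + (z * t) ^ 2 ≤ 1) :
    M ≤ α * (1 - x ^ 2) + β * (1 - y ^ 2) + γ * (1 - z ^ 2) + δ * (1 - t ^ 2) := by
  have e1 := mul_le_mul_of_nonneg_right hα (sub_nonneg.2 hx)
  have e2 := mul_le_mul_of_nonneg_right hβ (sub_nonneg.2 hy)
  have e3 := mul_le_mul_of_nonneg_right hγ (sub_nonneg.2 hz)
  have e4 := mul_le_mul_of_nonneg_right hδ (sub_nonneg.2 ht)
  have e5 := mul_nonneg hM (mul_nonneg (sub_nonneg.2 hx) (sub_nonneg.2 hy))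
  have e6 := mul_nonneg hM (mul_nonneg (sub_nonneg.2 hz) (sub_nonneg.2 ht))
  have e7 := mul_le_mul_of_nonneg_left h hM
  nlinarith

/-- Four plane vectors with determinants at most one: the weighted sum of squared determinants is
at most the sum obtained when all of them but one are one. -/
theorem four_vectors_le {W₀ W₁ W₂ W₃ B : ℝ} {p₀ p₁ p₂ p₃ : ℝ × ℝ}
    (h₀ : 0 ≤ W₀) (h₁ : 0 ≤ W₁) (h₂ : 0 ≤ W₂) (h₃ : 0 ≤ W₃)
    (d01 : planeDet p₀ p₁ ^ 2 ≤ 1) (d02 : planeDet p₀ p₂ ^ 2 ≤ 1) (d03 : planeDet p₀ p₃ ^ 2 ≤ 1)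
    (d12 : planeDet p₁ p₂ ^ 2 ≤ 1) (d13 : planeDet p₁ p₃ ^ 2 ≤ 1) (d23 : planeDet p₂ p₃ ^ 2 ≤ 1)
    (b01 : W₀ * W₂ + W₀ * W₃ + W₁ * W₂ + W₁ * W₃ + W₂ * W₃ ≤ B)
    (b02 : W₀ * W₁ + W₀ * W₃ + W₁ * W₂ + W₁ * W₃ + W₂ * W₃ ≤ B)
    (b03 : W₀ * W₁ + W₀ * W₂ + W₁ * W₂ + W₁ * W₃ + W₂ * W₃ ≤ B)
    (b12 : W₀ * W₁ + W₀ * W₂ + W₀ * W₃ + W₁ * W₃ + W₂ * W₃ ≤ B)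
    (b13 : W₀ * W₁ + W₀ * W₂ + W₀ * W₃ + W₁ * W₂ + W₂ * W₃ ≤ B)
    (b23 : W₀ * W₁ + W₀ * W₂ + W₀ * W₃ + W₁ * W₂ + W₁ * W₃ ≤ B) :
    W₀ * W₁ * planeDet p₀ p₁ ^ 2 + W₀ * W₂ * planeDet p₀ p₂ ^ 2 + W₀ * W₃ * planeDet p₀ p₃ ^ 2 +
      W₁ * W₂ * planeDet p₁ p₂ ^ 2 + W₁ * W₃ * planeDet p₁ p₃ ^ 2 + W₂ * W₃ * planeDet p₂ p₃ ^ 2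
      ≤ B := by
  have hp := planeDet_pluecker p₀ p₁ p₂ p₃
  generalize planeDet p₀ p₁ = a at *
  generalize planeDet p₀ p₂ = b at *
  generalize planeDet p₀ p₃ = c at *
  generalize planeDet p₁ p₂ = d at *
  generalize planeDet p₁ p₃ = e at *
  generalize planeDet p₂ p₃ = f at *
  have l01 := mul_nonneg (mul_nonneg h₀ h₁) (sub_nonneg.2 d01)
  have l02 := mul_nonneg (mul_nonneg h₀ h₂) (sub_nonneg.2 d02)
  have l03 := mul_nonneg (mul_nonneg h₀ h₃) (sub_nonneg.2 d03)
  have l12 := mul_nonneg (mul_nonneg h₁ h₂) (sub_nonneg.2 d12)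
  have l13 := mul_nonneg (mul_nonneg h₁ h₃) (sub_nonneg.2 d13)
  have l23 := mul_nonneg (mul_nonneg h₂ h₃) (sub_nonneg.2 d23)
  have q1 : (a * f) ^ 2 ≤ 1 := by rw [mul_pow]; exact mul_le_one₀ d01 (sq_nonneg _) d23
  have q2 : (b * e) ^ 2 ≤ 1 := by rw [mul_pow]; exact mul_le_one₀ d02 (sq_nonneg _) d13
  have q3 : (c * d) ^ 2 ≤ 1 := by rw [mul_pow]; exact mul_le_one₀ d03 (sq_nonneg _) d12
  -- `M` is the excess over `B` when all determinants are 1. The hypotheses say that dropping any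
  -- one pair removes it, so `M` is at most each product of two masses.
  obtain ⟨M, hM⟩ : ∃ M, M = W₀ * W₁ + W₀ * W₂ + W₀ * W₃ + W₁ * W₂ + W₁ * W₃ + W₂ * W₃ - B :=
    ⟨_, rfl⟩
  suffices M ≤ W₀ * W₁ * (1 - a ^ 2) + W₀ * W₂ * (1 - b ^ 2) + W₀ * W₃ * (1 - c ^ 2) +
      W₁ * W₂ * (1 - d ^ 2) + W₁ * W₃ * (1 - e ^ 2) + W₂ * W₃ * (1 - f ^ 2) by linarith
  rcases le_total M 0 with hM0 | hM0
  · linarith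
  have m01 : M ≤ W₀ * W₁ := by linarith
  have m02 : M ≤ W₀ * W₂ := by linarith
  have m03 : M ≤ W₀ * W₃ := by linarith
  have m12 : M ≤ W₁ * W₂ := by linarith
  have m13 : M ≤ W₁ * W₃ := by linarith
  have m23 : M ≤ W₂ * W₃ := by linarith
  -- Plücker reads `af + cd - be = 0`. Of the three numbers `af`, `cd`, `-be` two share a weak sign;
  -- the third has absolute value their sum, so the squares of those two add up to at most 1.
  have key : 0 ≤ (a * f) * (c * d) ∨ 0 ≤ -((a * f) * (b * e)) ∨ 0 ≤ -((c * d) * (b * e)) := by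
    rw [← hp]
    by_contra! hc
    obtain ⟨g1, g2, g3⟩ := hc
    have g := mul_pos (neg_lt_zero.1 (by linarith : -(a * f * (a * f + c * d)) < 0))
      (neg_lt_zero.1 (by linarith : -(c * d * (a * f + c * d)) < 0))
    nlinarith [mul_nonneg (neg_pos.2 g1).le (sq_nonneg (a * f + c * d))]
  rcases key with h | h | h
  · have : (a * f) ^ 2 + (c * d) ^ 2 ≤ 1 := by rw [← hp] at q2; nlinarith
    have := four_weights_loss hM0 m01 m23 m03 m12 d01 d23 d03 d12 this
    linarith
  · have h3 : c * d = b * e - a * f := by linarith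
    have : (a * f) ^ 2 + (b * e) ^ 2 ≤ 1 := by rw [h3] at q3; nlinarith
    have := four_weights_loss hM0 m01 m23 m02 m13 d01 d23 d02 d13 this
    linarith
  · have h3 : a * f = b * e - c * d := by linarith
    have : (c * d) ^ 2 + (b * e) ^ 2 ≤ 1 := by rw [h3] at q1; nlinarith
    have := four_weights_loss hM0 m03 m12 m02 m13 d03 d12 d02 d13 this
    linarith

/-- Four plane vectors of which all but the first have mass at most `m`. -/
theorem four_vectors_le_of_mass_le {m W₀ W₁ W₂ W₃ : ℝ} {p₀ p₁ p₂ p₃ : ℝ × ℝ} (hm : 1 / 6 ≤ m)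
    (h₀ : 0 ≤ W₀) (h₁ : 0 ≤ W₁) (h₂ : 0 ≤ W₂) (h₃ : 0 ≤ W₃)
    (m₁ : W₁ ≤ m) (m₂ : W₂ ≤ m) (m₃ : W₃ ≤ m) (hs : W₀ + W₁ + W₂ + W₃ + m = 1)
    (d01 : planeDet p₀ p₁ ^ 2 ≤ 1) (d02 : planeDet p₀ p₂ ^ 2 ≤ 1) (d03 : planeDet p₀ p₃ ^ 2 ≤ 1)
    (d12 : planeDet p₁ p₂ ^ 2 ≤ 1) (d13 : planeDet p₁ p₃ ^ 2 ≤ 1) (d23 : planeDet p₂ p₃ ^ 2 ≤ 1) :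
    W₀ * W₁ * planeDet p₀ p₁ ^ 2 + W₀ * W₂ * planeDet p₀ p₂ ^ 2 + W₀ * W₃ * planeDet p₀ p₃ ^ 2 +
      W₁ * W₂ * planeDet p₁ p₂ ^ 2 + W₁ * W₃ * planeDet p₁ p₃ ^ 2 + W₂ * W₃ * planeDet p₂ p₃ ^ 2
      ≤ 2 / 9 := by
  -- Dropping the product of two masses amounts to merging them. Some mass other than `W₀` stays
  -- unmerged and serves as the one bounded by `m`.
  have b01 := three_masses_le hm h₂ (add_nonneg h₀ h₁) h₃ m₂ (by linarith)
  have b02 := three_masses_le hm h₁ (add_nonneg h₀ h₂) h₃ m₁ (by linarith)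
  have b03 := three_masses_le hm h₁ (add_nonneg h₀ h₃) h₂ m₁ (by linarith)
  have b12 := three_masses_le hm h₃ (add_nonneg h₁ h₂) h₀ m₃ (by linarith)
  have b13 := three_masses_le hm h₂ (add_nonneg h₁ h₃) h₀ m₂ (by linarith)
  have b23 := three_masses_le hm h₁ (add_nonneg h₂ h₃) h₀ m₁ (by linarith)
  apply four_vectors_le h₀ h₁ h₂ h₃ d01 d02 d03 d12 d13 d23 <;> linarith

/-! ### Inequalities for the pentagonal configuration -/

/-- With `v = 1 - t * u`, the numbers `t, e, v, f, u` in cyclic order satisfy a pentagram rule: the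
product of two neighbours is 1 minus the opposite number. Hence `f * v = 1 - t` and `e * v = 1 - u`.
Multiplying by `v ^ 2` eliminates `e` and `f` and leaves a polynomial inequality in `v` and `k = (1
- t) * (1 - u)`. -/
theorem pentagon_sum_sq_le {t u e f : ℝ} (ht : 0 ≤ t) (ht1 : t ≤ 1) (hu : 0 ≤ u) (hu1 : u ≤ 1)
    (he : 0 ≤ e) (he1 : e ≤ 1) (hf : 0 ≤ f) (hf1 : f ≤ 1)
    (h1 : t * e + f = 1) (h2 : u * f + e = 1) :
    t ^ 2 + u ^ 2 + e ^ 2 + f ^ 2 + (1 - t * u) ^ 2 ≤ 3 := by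
  obtain ⟨s, rfl⟩ : ∃ s, t = 1 - s := ⟨1 - t, by ring⟩
  obtain ⟨r, rfl⟩ : ∃ r, u = 1 - r := ⟨1 - u, by ring⟩
  obtain ⟨v, hv⟩ : ∃ v, v = s + r - s * r := ⟨_, rfl⟩
  have hs : 0 ≤ s := by linarith
  have hr : 0 ≤ r := by linarith
  have hvs : s ≤ v := by nlinarith
  have hvr : r ≤ v := by nlinarith
  have hfv : f * v = s := by rw [hv]; linear_combination h1 - (1 - s) * h2
  have hev : e * v = r := by rw [hv]; linear_combination h2 - (1 - r) * h1
  have hv1 : v ≤ 1 := by nlinarith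
  rcases (hs.trans hvs).eq_or_lt with hv0 | hv0
  · have : s = 0 := by linarith
    have : r = 0 := by linarith
    subst s r
    nlinarith
  obtain ⟨k, hk⟩ : ∃ k, k = s * r := ⟨_, rfl⟩
  have hk0 : 0 ≤ k := by rw [hk]; positivity
  have hkv : k ≤ v ^ 2 := by rw [hk, sq]; exact mul_le_mul hvs hvr hr hv0.le
  have main : k ^ 2 * (1 + v ^ 2) - 4 * k * v ^ 2 + 2 * k * v ^ 3 ≤ 2 * (1 - v) * (v ^ 3 + k) := by
    have a1 : k ^ 2 * (1 + v ^ 2) ≤ k * v ^ 2 * (1 + v ^ 2) := by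
      have := mul_le_mul_of_nonneg_left hkv (mul_nonneg hk0 (by positivity : 0 ≤ 1 + v ^ 2))
      nlinarith
    have a2 : k * v ^ 2 * ((v + 3) * (v - 1)) ≤ 0 :=
      mul_nonpos_of_nonneg_of_nonpos (by positivity)
        (mul_nonpos_of_nonneg_of_nonpos (by linarith) (by linarith))
    have a3 : 0 ≤ 2 * (1 - v) * (v ^ 3 + k) := by
      have : 0 ≤ 1 - v := by linarith
      positivity
    nlinarith
  have hw : 1 - (1 - s) * (1 - r) = v := by rw [hv]; ring
  rw [hw]
  have hsr : s + r = v + k := by rw [hv, hk]; ring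
  have : v ^ 2 * ((1 - s) ^ 2 + (1 - r) ^ 2 + e ^ 2 + f ^ 2 + v ^ 2) ≤ v ^ 2 * 3 := by
    have e1 : v ^ 2 * (e ^ 2 + f ^ 2) = (v + k) ^ 2 - 2 * k := by
      have : v ^ 2 * (e ^ 2 + f ^ 2) = (e * v) ^ 2 + (f * v) ^ 2 := by ring
      rw [this, hfv, hev, ← hsr, hk]; ring
    have e2 : (1 - s) ^ 2 + (1 - r) ^ 2 = 2 - 2 * (v + k) + (v + k) ^ 2 - 2 * k := by
      rw [← hsr, hk]; ring
    have : v ^ 2 * ((1 - s) ^ 2 + (1 - r) ^ 2 + e ^ 2 + f ^ 2 + v ^ 2) =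
      v ^ 2 * (e ^ 2 + f ^ 2) + v ^ 2 * ((1 - s) ^ 2 + (1 - r) ^ 2) + v ^ 4 := by ring
    rw [this, e1, e2]
    nlinarith
  exact le_of_mul_le_mul_left this (by positivity)

/-- If `M ≤ 2 * b₁`, replace all weights by the smallest one. Otherwise use `b₂, b₅ ≥ M - b₁`, and
for the opposite edge `b₃ + b₄ ≥ M` on the smaller of `l₃, l₄` and `b₁` on their difference. The
bound becomes `b₁ * ∑ l + (M - 2 * b₁) * (three capacities)`, which is at least `M`. -/
theorem five_cycle_loss_of_min {M b₁ b₂ b₃ b₄ b₅ l₁ l₂ l₃ l₄ l₅ : ℝ} (hb : 0 ≤ b₁)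
    (h13 : b₁ ≤ b₃) (h14 : b₁ ≤ b₄)
    (s12 : M ≤ b₁ + b₂) (s34 : M ≤ b₃ + b₄) (s51 : M ≤ b₅ + b₁)
    (h12 : b₁ ≤ b₂) (h15 : b₁ ≤ b₅)
    (n₂ : 0 ≤ l₂) (n₃ : 0 ≤ l₃) (n₄ : 0 ≤ l₄) (n₅ : 0 ≤ l₅)
    (hl : 2 ≤ l₁ + l₂ + l₃ + l₄ + l₅) (c13 : 1 ≤ l₂ + l₄ + l₅) (c14 : 1 ≤ l₂ + l₃ + l₅) :
    M ≤ b₁ * l₁ + b₂ * l₂ + b₃ * l₃ + b₄ * l₄ + b₅ * l₅ := by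
  rcases le_total M (2 * b₁) with h | h
  · nlinarith [mul_nonneg (sub_nonneg.2 h13) n₃, mul_nonneg (sub_nonneg.2 h14) n₄,
      mul_nonneg (sub_nonneg.2 h12) n₂, mul_nonneg (sub_nonneg.2 h15) n₅,
      mul_le_mul_of_nonneg_left hl hb]
  · have e2 : (M - b₁) * l₂ ≤ b₂ * l₂ := mul_le_mul_of_nonneg_right (by linarith) n₂
    have e5 : (M - b₁) * l₅ ≤ b₅ * l₅ := mul_le_mul_of_nonneg_right (by linarith) n₅
    have e0 := mul_le_mul_of_nonneg_left hl hb
    rcases le_total l₄ l₃ with hh | hh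
    · have := mul_nonneg (sub_nonneg.2 h13) (sub_nonneg.2 hh)
      have := mul_nonneg (sub_nonneg.2 s34) n₄
      have := mul_nonneg (sub_nonneg.2 h) (sub_nonneg.2 c13)
      nlinarith
    · have := mul_nonneg (sub_nonneg.2 h14) (sub_nonneg.2 hh)
      have := mul_nonneg (sub_nonneg.2 s34) n₃
      have := mul_nonneg (sub_nonneg.2 h) (sub_nonneg.2 c14)
      nlinarith

/-- Weights on a five-cycle with adjacent sums at least `M`, tested against capacities under which
the five-cycle has a fractional matching of size one. -/
theorem five_cycle_loss {M b₁ b₂ b₃ b₄ b₅ l₁ l₂ l₃ l₄ l₅ : ℝ}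
    (p₁ : 0 ≤ b₁) (p₂ : 0 ≤ b₂) (p₃ : 0 ≤ b₃) (p₄ : 0 ≤ b₄) (p₅ : 0 ≤ b₅)
    (s12 : M ≤ b₁ + b₂) (s23 : M ≤ b₂ + b₃) (s34 : M ≤ b₃ + b₄) (s45 : M ≤ b₄ + b₅)
    (s51 : M ≤ b₅ + b₁)
    (n₁ : 0 ≤ l₁) (n₂ : 0 ≤ l₂) (n₃ : 0 ≤ l₃) (n₄ : 0 ≤ l₄) (n₅ : 0 ≤ l₅)
    (hl : 2 ≤ l₁ + l₂ + l₃ + l₄ + l₅)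
    (c13 : 1 ≤ l₂ + l₄ + l₅) (c14 : 1 ≤ l₂ + l₃ + l₅) (c24 : 1 ≤ l₁ + l₃ + l₅)
    (c25 : 1 ≤ l₁ + l₃ + l₄) (c35 : 1 ≤ l₁ + l₂ + l₄) :
    M ≤ b₁ * l₁ + b₂ * l₂ + b₃ * l₃ + b₄ * l₄ + b₅ * l₅ := by
  have hmin : (b₁ ≤ b₂ ∧ b₁ ≤ b₃ ∧ b₁ ≤ b₄ ∧ b₁ ≤ b₅) ∨ (b₂ ≤ b₁ ∧ b₂ ≤ b₃ ∧ b₂ ≤ b₄ ∧ b₂ ≤ b₅) ∨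
      (b₃ ≤ b₁ ∧ b₃ ≤ b₂ ∧ b₃ ≤ b₄ ∧ b₃ ≤ b₅) ∨ (b₄ ≤ b₁ ∧ b₄ ≤ b₂ ∧ b₄ ≤ b₃ ∧ b₄ ≤ b₅) ∨
      (b₅ ≤ b₁ ∧ b₅ ≤ b₂ ∧ b₅ ≤ b₃ ∧ b₅ ≤ b₄) := by grind
  rcases hmin with ⟨x, y, z, w⟩ | ⟨x, y, z, w⟩ | ⟨x, y, z, w⟩ | ⟨x, y, z, w⟩ | ⟨x, y, z, w⟩
  · exact five_cycle_loss_of_min p₁ y z s12 s34 s51 x w n₂ n₃ n₄ n₅ hl c13 c14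
  · have := five_cycle_loss_of_min (l₁ := l₂) p₂ z w s23 s45 s12 y x n₃ n₄ n₅ n₁ (by linarith)
      (by linarith) (by linarith)
    linarith
  · have := five_cycle_loss_of_min (l₁ := l₃) p₃ w x s34 s51 s23 z y n₄ n₅ n₁ n₂ (by linarith)
      (by linarith) (by linarith)
    linarith
  · have := five_cycle_loss_of_min (l₁ := l₄) p₄ x y s45 s12 s34 w z n₅ n₁ n₂ n₃ (by linarith)
      (by linarith) (by linarith)
    linarith
  · have := five_cycle_loss_of_min (l₁ := l₅) p₅ y z s51 s23 s45 x w n₁ n₂ n₃ n₄ (by linarith)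
      (by linarith) (by linarith)
    linarith

theorem sq_add_sq_add_sq_one_sub_mul_le {p q : ℝ} (hp : 0 ≤ p) (hp1 : p ≤ 1) (hq : 0 ≤ q)
    (hq1 : q ≤ 1) : p ^ 2 + q ^ 2 + (1 - p * q) ^ 2 ≤ 2 := by
  have h := mul_le_one₀ hp1 hq hq1
  nlinarith [mul_nonneg (mul_nonneg hp hq) (sub_nonneg.2 h),
    mul_nonneg (by nlinarith : 0 ≤ 1 - p ^ 2) (by nlinarith : 0 ≤ 1 - q ^ 2)]

/-! ### Five weighted plane vectors: degenerate cases, convexity and the pentagon -/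

/-- Five masses, each at most `m`, that together with `m` have total mass one. -/
structure IsMassTuple (m w₀ w₁ w₂ w₃ w₄ : ℝ) : Prop where
  le_m : 1 / 6 ≤ m
  nonneg₀ : 0 ≤ w₀
  nonneg₁ : 0 ≤ w₁
  nonneg₂ : 0 ≤ w₂
  nonneg₃ : 0 ≤ w₃
  nonneg₄ : 0 ≤ w₄
  le₀ : w₀ ≤ m
  le₁ : w₁ ≤ m
  le₂ : w₂ ≤ m
  le₃ : w₃ ≤ m
  le₄ : w₄ ≤ m
  sum_eq : w₀ + w₁ + w₂ + w₃ + w₄ + m = 1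

/-- The weighted sum of the squared determinants of the pairs among five vectors of the plane. -/
def fiveSum (w₀ w₁ w₂ w₃ w₄ : ℝ) (p₀ p₁ p₂ p₃ p₄ : ℝ × ℝ) : ℝ :=
  w₀ * w₁ * planeDet p₀ p₁ ^ 2 + w₀ * w₂ * planeDet p₀ p₂ ^ 2 + w₀ * w₃ * planeDet p₀ p₃ ^ 2 +
  w₀ * w₄ * planeDet p₀ p₄ ^ 2 + w₁ * w₂ * planeDet p₁ p₂ ^ 2 + w₁ * w₃ * planeDet p₁ p₃ ^ 2 +
  w₁ * w₄ * planeDet p₁ p₄ ^ 2 + w₂ * w₃ * planeDet p₂ p₃ ^ 2 + w₂ * w₄ * planeDet p₂ p₄ ^ 2 +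
  w₃ * w₄ * planeDet p₃ p₄ ^ 2

section FiveVectors

variable {m w₀ w₁ w₂ w₃ w₄ : ℝ} {p₀ p₁ p₂ p₃ p₄ : ℝ × ℝ}

theorem fiveSum_swap01 : fiveSum w₀ w₁ w₂ w₃ w₄ p₀ p₁ p₂ p₃ p₄ =
    fiveSum w₁ w₀ w₂ w₃ w₄ p₁ p₀ p₂ p₃ p₄ := by
  unfold fiveSum planeDet; ring

theorem fiveSum_swap03 : fiveSum w₀ w₁ w₂ w₃ w₄ p₀ p₁ p₂ p₃ p₄ =
    fiveSum w₃ w₁ w₂ w₀ w₄ p₃ p₁ p₂ p₀ p₄ := by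
  unfold fiveSum planeDet; ring

theorem fiveSum_swap23 : fiveSum w₀ w₁ w₂ w₃ w₄ p₀ p₁ p₂ p₃ p₄ =
    fiveSum w₀ w₁ w₃ w₂ w₄ p₀ p₁ p₃ p₂ p₄ := by
  unfold fiveSum planeDet; ring

theorem fiveSum_swap34 : fiveSum w₀ w₁ w₂ w₃ w₄ p₀ p₁ p₂ p₃ p₄ =
    fiveSum w₀ w₁ w₂ w₄ w₃ p₀ p₁ p₂ p₄ p₃ := by
  unfold fiveSum planeDet; ring

theorem IsMassTuple.swap01 (h : IsMassTuple m w₀ w₁ w₂ w₃ w₄) :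
    IsMassTuple m w₁ w₀ w₂ w₃ w₄ := by
  obtain ⟨a, b, c, d, e, f, g, i, j, k, l, s⟩ := h
  constructor <;> linarith

theorem IsMassTuple.swap03 (h : IsMassTuple m w₀ w₁ w₂ w₃ w₄) :
    IsMassTuple m w₃ w₁ w₂ w₀ w₄ := by
  obtain ⟨a, b, c, d, e, f, g, i, j, k, l, s⟩ := h
  constructor <;> linarith

theorem IsMassTuple.swap23 (h : IsMassTuple m w₀ w₁ w₂ w₃ w₄) :
    IsMassTuple m w₀ w₁ w₃ w₂ w₄ := by
  obtain ⟨a, b, c, d, e, f, g, i, j, k, l, s⟩ := h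
  constructor <;> linarith

theorem IsMassTuple.swap34 (h : IsMassTuple m w₀ w₁ w₂ w₃ w₄) :
    IsMassTuple m w₀ w₁ w₂ w₄ w₃ := by
  obtain ⟨a, b, c, d, e, f, g, i, j, k, l, s⟩ := h
  constructor <;> linarith

/-- Equal vectors merge into one of mass `w₀ + w₂`. This mass may exceed `m`, which is why
`four_vectors_le_of_mass_le` leaves its first mass unbounded. -/
theorem fiveSum_le_of_eq_first (h : IsMassTuple m w₀ w₁ w₂ w₃ w₄)
    (d01 : planeDet p₀ p₁ ^ 2 ≤ 1) (d03 : planeDet p₀ p₃ ^ 2 ≤ 1) (d04 : planeDet p₀ p₄ ^ 2 ≤ 1)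
    (d13 : planeDet p₁ p₃ ^ 2 ≤ 1) (d14 : planeDet p₁ p₄ ^ 2 ≤ 1) (d34 : planeDet p₃ p₄ ^ 2 ≤ 1) :
    fiveSum w₀ w₁ w₂ w₃ w₄ p₀ p₁ p₀ p₃ p₄ ≤ 2 / 9 := by
  have := four_vectors_le_of_mass_le h.le_m (add_nonneg h.nonneg₀ h.nonneg₂) h.nonneg₁ h.nonneg₃
    h.nonneg₄ h.le₁ h.le₃ h.le₄ (by linarith [h.sum_eq]) d01 d03 d04 d13 d14 d34
  refine le_of_eq_of_le ?_ this
  unfold fiveSum planeDet; ring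

/-- The bound when the third vector vanishes or coincides with one of the first two. -/
theorem fiveSum_le_of_eq (h : IsMassTuple m w₀ w₁ w₂ w₃ w₄)
    (hp : p₂ = 0 ∨ p₂ = p₀ ∨ p₂ = p₁)
    (d01 : planeDet p₀ p₁ ^ 2 ≤ 1) (d03 : planeDet p₀ p₃ ^ 2 ≤ 1) (d04 : planeDet p₀ p₄ ^ 2 ≤ 1)
    (d13 : planeDet p₁ p₃ ^ 2 ≤ 1) (d14 : planeDet p₁ p₄ ^ 2 ≤ 1) (d34 : planeDet p₃ p₄ ^ 2 ≤ 1) :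
    fiveSum w₀ w₁ w₂ w₃ w₄ p₀ p₁ p₂ p₃ p₄ ≤ 2 / 9 := by
  rcases hp with rfl | rfl | rfl
  -- Replacing the zero vector by `p₀` only adds nonnegative terms.
  · refine le_trans ?_ (fiveSum_le_of_eq_first h d01 d03 d04 d13 d14 d34)
    have a1 := mul_nonneg (mul_nonneg h.nonneg₁ h.nonneg₂) (sq_nonneg (planeDet p₁ p₀))
    have a2 := mul_nonneg (mul_nonneg h.nonneg₂ h.nonneg₃) (sq_nonneg (planeDet p₀ p₃))
    have a3 := mul_nonneg (mul_nonneg h.nonneg₂ h.nonneg₄) (sq_nonneg (planeDet p₀ p₄))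
    have b1 (q : ℝ × ℝ) : planeDet q 0 = 0 := by simp [planeDet]
    have b2 (q : ℝ × ℝ) : planeDet 0 q = 0 := by simp [planeDet]
    simp only [fiveSum, b1, b2, planeDet_self]
    linarith
  · exact fiveSum_le_of_eq_first h d01 d03 d04 d13 d14 d34
  · rw [fiveSum_swap01]
    exact fiveSum_le_of_eq_first h.swap01 (by rwa [planeDet_swap_sq]) d13 d14 d03 d04 d34

theorem fiveSum_le_of_eq_fourth (h : IsMassTuple m w₀ w₁ w₂ w₃ w₄) (hp : p₂ = p₃)
    (d01 : planeDet p₀ p₁ ^ 2 ≤ 1) (d03 : planeDet p₀ p₃ ^ 2 ≤ 1) (d04 : planeDet p₀ p₄ ^ 2 ≤ 1)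
    (d13 : planeDet p₁ p₃ ^ 2 ≤ 1) (d14 : planeDet p₁ p₄ ^ 2 ≤ 1) (d34 : planeDet p₃ p₄ ^ 2 ≤ 1) :
    fiveSum w₀ w₁ w₂ w₃ w₄ p₀ p₁ p₂ p₃ p₄ ≤ 2 / 9 := by
  subst hp
  rw [fiveSum_swap03]
  exact fiveSum_le_of_eq_first h.swap03 (by rwa [planeDet_swap_sq]) (by rwa [planeDet_swap_sq]) d34
    (by rwa [planeDet_swap_sq]) d14 d04

/-- Convexity along segments, in the weak form used for maximising over a polygon. -/
def SegmentBounded (F : ℝ × ℝ → ℝ) (B : ℝ) : Prop :=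
  ∀ q r : ℝ × ℝ, ∀ t : ℝ, 0 ≤ t → t ≤ 1 → F q ≤ B → F r ≤ B →
    F ((1 - t) * q.1 + t * r.1, (1 - t) * q.2 + t * r.2) ≤ B

/-- Each term is constant or a nonnegative multiple of the square of a linear form in the moving
vector, so the sum is convex in it. The terms subtracted in `e` are the convexity defect. -/
theorem segmentBounded_fiveSum (h : IsMassTuple m w₀ w₁ w₂ w₃ w₄) (B : ℝ) :
    SegmentBounded (fun p ↦ fiveSum w₀ w₁ w₂ w₃ w₄ p₀ p₁ p p₃ p₄) B := by
  intro q r t ht0 ht1 hq hr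
  have hs : 0 ≤ t * (1 - t) := mul_nonneg ht0 (by linarith)
  set z : ℝ × ℝ := (q.1 - r.1, q.2 - r.2) with hz
  have a0 := mul_nonneg hs (mul_nonneg (mul_nonneg h.nonneg₀ h.nonneg₂) (sq_nonneg (planeDet p₀ z)))
  have a1 := mul_nonneg hs (mul_nonneg (mul_nonneg h.nonneg₁ h.nonneg₂) (sq_nonneg (planeDet p₁ z)))
  have a3 := mul_nonneg hs (mul_nonneg (mul_nonneg h.nonneg₂ h.nonneg₃) (sq_nonneg (planeDet z p₃)))
  have a4 := mul_nonneg hs (mul_nonneg (mul_nonneg h.nonneg₂ h.nonneg₄) (sq_nonneg (planeDet z p₄)))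
  have b1 := mul_le_mul_of_nonneg_left hq (sub_nonneg.2 ht1)
  have b2 := mul_le_mul_of_nonneg_left hr ht0
  have e : fiveSum w₀ w₁ w₂ w₃ w₄ p₀ p₁ ((1 - t) * q.1 + t * r.1, (1 - t) * q.2 + t * r.2) p₃ p₄ =
      (1 - t) * fiveSum w₀ w₁ w₂ w₃ w₄ p₀ p₁ q p₃ p₄ + t * fiveSum w₀ w₁ w₂ w₃ w₄ p₀ p₁ r p₃ p₄ -
      t * (1 - t) * (w₀ * w₂ * planeDet p₀ z ^ 2) - t * (1 - t) * (w₁ * w₂ * planeDet p₁ z ^ 2) -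
      t * (1 - t) * (w₂ * w₃ * planeDet z p₃ ^ 2) - t * (1 - t) * (w₂ * w₄ * planeDet z p₄ ^ 2) := by
    simp only [fiveSum, planeDet, hz]; ring
  simp only at b1 b2 ⊢
  rw [e]
  linarith

theorem SegmentBounded.le_of_mem_square {F : ℝ × ℝ → ℝ} {B a b : ℝ} (hF : SegmentBounded F B)
    (ha : 0 ≤ a) (ha1 : a ≤ 1) (hb : 0 ≤ b) (hb1 : b ≤ 1)
    (h00 : F (0, 0) ≤ B) (h10 : F (1, 0) ≤ B) (h01 : F (0, 1) ≤ B) (h11 : F (1, 1) ≤ B) :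
    F (a, b) ≤ B := by
  have x0 := hF (0, 0) (0, 1) b hb hb1 h00 h01
  have x1 := hF (1, 0) (1, 1) b hb hb1 h10 h11
  have := hF _ _ a ha ha1 x0 x1
  convert this using 2
  ext
  · simp
  · simp; ring

/-- The line `x * f + y * e = 1` cuts the corner `(1, 1)` off the unit square, at `(1, t)` and `(u,
1)`. The point is reached along the horizontal chord through it, whose ends lie on sides of the
pentagon. -/
theorem SegmentBounded.le_of_mem_pentagon {F : ℝ × ℝ → ℝ} {B a b t u e f : ℝ}
    (hF : SegmentBounded F B) (ha : 0 ≤ a) (ha1 : a ≤ 1) (hb : 0 ≤ b) (hb1 : b ≤ 1)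
    (ht : 0 ≤ t) (ht1 : t < 1) (hf : 0 < f) (h1 : t * e + f = 1)
    (h2 : u * f + e = 1) (hab : a * f + b * e ≤ 1)
    (h00 : F (0, 0) ≤ B) (h10 : F (1, 0) ≤ B) (h01 : F (0, 1) ≤ B) (hP : F (1, t) ≤ B)
    (hR : F (u, 1) ≤ B) : F (a, b) ≤ B := by
  have x0 : F (0, b) ≤ B := by
    have := hF (0, 0) (0, 1) b hb hb1 h00 h01
    convert this using 2
    ext <;> simp
  rcases le_total b t with hbt | hbt
  · have x1 : F (1, b) ≤ B := by
      have := hF (1, 0) (1, t) (b / t) (by positivity) (div_le_one_of_le₀ hbt ht) h10 hP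
      convert this using 2
      ext
      · simp
      · rcases ht.eq_or_lt with h | h
        · subst h; simp; linarith
        · simp; field_simp
    have := hF _ _ a ha ha1 x0 x1
    convert this using 2
    ext
    · simp
    · simp; ring
  · have h1t : 0 < 1 - t := by linarith
    have hl1 : (b - t) / (1 - t) ≤ 1 := div_le_one_of_le₀ (by linarith) h1t.le
    have hl0 : 0 ≤ (b - t) / (1 - t) := div_nonneg (by linarith) h1t.le
    have x1 := hF (1, t) (u, 1) ((b - t) / (1 - t)) hl0 hl1 hP hR
    set l := (b - t) / (1 - t) with hl
    have hlt : (1 - l) * t + l = b := by rw [hl]; field_simp; ring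
    simp only [mul_one, hlt] at x1
    -- `X` is the abscissa where the cutting line meets height `b`.
    set X := 1 - l + l * u with hX
    have hXl : X * f + b * e = 1 := by
      rw [hX, ← hlt]; linear_combination (1 - l) * h1 + l * h2
    have haX : a ≤ X := le_of_mul_le_mul_right (by linarith) hf
    rcases ha.eq_or_lt with h | h
    · rw [← h]; exact x0
    have hX0 : 0 < X := by linarith
    have := hF _ _ (a / X) (by positivity) (div_le_one_of_le₀ haX hX0.le) x0 x1
    convert this using 2
    ext
    · simp; field_simp
    · simp; ring

/-- Five of the ten pairs have squared determinant 1; the others have absolute determinants `t, e,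
v, f, u`, neighbours in the five-cycle belonging to disjoint pairs of vectors. Merging both disjoint
pairs leaves three masses, so `three_masses_le` gives the adjacent-sum conditions of
`five_cycle_loss`. The pentagram rule gives its capacity conditions. -/
theorem fiveSum_pentagon_le {t u e f : ℝ} (h : IsMassTuple m w₀ w₁ w₂ w₃ w₄)
    (ht : 0 ≤ t) (ht1 : t ≤ 1) (hu : 0 ≤ u) (hu1 : u ≤ 1)
    (he : 0 ≤ e) (he1 : e ≤ 1) (hf : 0 ≤ f) (hf1 : f ≤ 1)
    (h1 : t * e + f = 1) (h2 : u * f + e = 1) :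
    fiveSum w₀ w₁ w₂ w₃ w₄ (1, 0) (0, 1) (1, t) (u, 1) (e, -f) ≤ 2 / 9 := by
  obtain ⟨v, hv⟩ : ∃ v, v = 1 - t * u := ⟨_, rfl⟩
  have hsum := pentagon_sum_sq_le ht ht1 hu hu1 he he1 hf hf1 h1 h2
  rw [← hv] at hsum
  have hv0 : 0 ≤ v := by rw [hv]; nlinarith
  have hv1 : v ≤ 1 := by rw [hv]; nlinarith
  have et : t = 1 - f * v := by rw [hv]; linear_combination h1 - t * h2
  have eu : u = 1 - e * v := by rw [hv]; linear_combination h2 - u * h1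
  have c1 := sq_add_sq_add_sq_one_sub_mul_le ht ht1 he he1
  have c2 := sq_add_sq_add_sq_one_sub_mul_le hu hu1 hf hf1
  have c3 := sq_add_sq_add_sq_one_sub_mul_le hf hf1 hv0 hv1
  have c4 := sq_add_sq_add_sq_one_sub_mul_le he he1 hv0 hv1
  have c5 := sq_add_sq_add_sq_one_sub_mul_le ht ht1 hu hu1
  rw [← eu] at c4
  rw [← et] at c3
  rw [← hv] at c5
  rw [show 1 - t * e = f by linarith] at c1
  rw [show 1 - u * f = e by linarith] at c2
  obtain ⟨hm, n0, n1, n2, n3, n4, l0, l1, l2, l3, l4, hs⟩ := h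
  have s1 := three_masses_le hm n3 (add_nonneg n0 n2) (add_nonneg n1 n4) l3 (by linarith only [hs])
  have s2 := three_masses_le hm n4 (add_nonneg n0 n2) (add_nonneg n1 n3) l4 (by linarith only [hs])
  have s3 := three_masses_le hm n2 (add_nonneg n0 n4) (add_nonneg n1 n3) l2 (by linarith only [hs])
  have s4 := three_masses_le hm n1 (add_nonneg n0 n4) (add_nonneg n2 n3) l1 (by linarith only [hs])
  have s5 := three_masses_le hm n0 (add_nonneg n1 n4) (add_nonneg n2 n3) l0 (by linarith only [hs])
  have sqle (x : ℝ) (h0 : 0 ≤ x) (h1 : x ≤ 1) : 0 ≤ 1 - x ^ 2 :=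
    sub_nonneg.2 (pow_le_one₀ h0 h1)
  have key := five_cycle_loss
    (M := w₀ * w₁ + w₀ * w₂ + w₀ * w₃ + w₀ * w₄ + w₁ * w₂ + w₁ * w₃ + w₁ * w₄ + w₂ * w₃ + w₂ * w₄
      + w₃ * w₄ - 2 / 9)
    (b₁ := w₀ * w₂) (b₂ := w₁ * w₄) (b₃ := w₂ * w₃) (b₄ := w₀ * w₄) (b₅ := w₁ * w₃)
    (l₁ := 1 - t ^ 2) (l₂ := 1 - e ^ 2) (l₃ := 1 - v ^ 2) (l₄ := 1 - f ^ 2) (l₅ := 1 - u ^ 2)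
    (by positivity) (by positivity) (by positivity) (by positivity) (by positivity)
    (by linarith only [s1]) (by linarith only [s5]) (by linarith only [s4])
    (by linarith only [s3]) (by linarith only [s2])
    (sqle _ ht ht1) (sqle _ he he1) (sqle _ hv0 hv1) (sqle _ hf hf1) (sqle _ hu hu1)
    (by linarith only [hsum]) (by linarith only [c2]) (by linarith only [c4])
    (by linarith only [c5]) (by linarith only [c3]) (by linarith only [c1])
  have e34 : u * f + e = 1 := h2
  have e24 : f + t * e = 1 := by linarith
  have : fiveSum w₀ w₁ w₂ w₃ w₄ (1, 0) (0, 1) (1, t) (u, 1) (e, -f) =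
      w₀ * w₁ + w₀ * w₂ * t ^ 2 + w₀ * w₃ + w₀ * w₄ * f ^ 2 + w₁ * w₂ + w₁ * w₃ * u ^ 2 +
      w₁ * w₄ * e ^ 2 + w₂ * w₃ * v ^ 2 + w₂ * w₄ * (f + t * e) ^ 2 +
      w₃ * w₄ * (u * f + e) ^ 2 := by
    simp only [fiveSum, planeDet, hv]; ring
  rw [this, e24, e34]
  linarith only [key]

end FiveVectors

/-! ### Reduction to vertices, quadrants and signs -/

section FiveVectors

variable {m w₀ w₁ w₂ w₃ w₄ : ℝ} {p₂ p₃ p₄ : ℝ × ℝ}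

theorem planeDet_sq_le_one_iff {p q : ℝ × ℝ} : planeDet p q ^ 2 ≤ 1 ↔ |planeDet p q| ≤ 1 :=
  sq_le_one_iff_abs_le_one _

/-- Unless `p₂` and `p₃` are `r` and `s` in some order, one of them is zero or repeats another
vector, and the four-vector bound applies. -/
theorem fiveSum_vertices_le (h : IsMassTuple m w₀ w₁ w₂ w₃ w₄) {r s : ℝ × ℝ}
    (hr0 : planeDet (1, 0) r ^ 2 ≤ 1) (hr1 : planeDet (0, 1) r ^ 2 ≤ 1)
    (hs0 : planeDet (1, 0) s ^ 2 ≤ 1) (hs1 : planeDet (0, 1) s ^ 2 ≤ 1)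
    (h40 : planeDet (1, 0) p₄ ^ 2 ≤ 1) (h41 : planeDet (0, 1) p₄ ^ 2 ≤ 1)
    (hr4 : planeDet r p₄ ^ 2 ≤ 1) (hs4 : planeDet s p₄ ^ 2 ≤ 1)
    (hrs : fiveSum w₀ w₁ w₂ w₃ w₄ (1, 0) (0, 1) r s p₄ ≤ 2 / 9)
    (hsr : fiveSum w₀ w₁ w₂ w₃ w₄ (1, 0) (0, 1) s r p₄ ≤ 2 / 9)
    (h2 : p₂ = 0 ∨ p₂ = (1, 0) ∨ p₂ = (0, 1) ∨ p₂ = r ∨ p₂ = s)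
    (h3 : p₃ = 0 ∨ p₃ = (1, 0) ∨ p₃ = (0, 1) ∨ p₃ = r ∨ p₃ = s) :
    fiveSum w₀ w₁ w₂ w₃ w₄ (1, 0) (0, 1) p₂ p₃ p₄ ≤ 2 / 9 := by
  have d01 : planeDet ((1, 0) : ℝ × ℝ) (0, 1) ^ 2 ≤ 1 := by simp [planeDet]
  have z (p : ℝ × ℝ) (hp0 : planeDet (1, 0) p ^ 2 ≤ 1) (hp1 : planeDet (0, 1) p ^ 2 ≤ 1)
      (hp4 : planeDet p p₄ ^ 2 ≤ 1) (h' : p₃ = 0 ∨ p₃ = (1, 0) ∨ p₃ = (0, 1)) :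
      fiveSum w₀ w₁ w₂ w₃ w₄ (1, 0) (0, 1) p p₃ p₄ ≤ 2 / 9 := by
    rw [fiveSum_swap23]
    exact fiveSum_le_of_eq h.swap23 h' d01 hp0 h40 hp1 h41 hp4
  have g (p : ℝ × ℝ) (hp : p = 0 ∨ p = (1, 0) ∨ p = (0, 1) ∨ p = r ∨ p = s) :
      planeDet (1, 0) p ^ 2 ≤ 1 ∧ planeDet (0, 1) p ^ 2 ≤ 1 ∧ planeDet p p₄ ^ 2 ≤ 1 := by
    rcases hp with rfl | rfl | rfl | rfl | rfl
    · simp [planeDet]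
    · exact ⟨by simp [planeDet], by simp [planeDet], h40⟩
    · exact ⟨by simp [planeDet], by simp [planeDet], h41⟩
    · exact ⟨hr0, hr1, hr4⟩
    · exact ⟨hs0, hs1, hs4⟩
  by_cases h2' : p₂ = 0 ∨ p₂ = (1, 0) ∨ p₂ = (0, 1)
  · obtain ⟨g0, g1, g4⟩ := g _ h3
    exact fiveSum_le_of_eq h h2' d01 g0 h40 g1 h41 g4
  by_cases h3' : p₃ = 0 ∨ p₃ = (1, 0) ∨ p₃ = (0, 1)
  · obtain ⟨g0, g1, g4⟩ := g _ h2
    exact z _ g0 g1 g4 h3'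
  have h2 : p₂ = r ∨ p₂ = s := by tauto
  have h3 : p₃ = r ∨ p₃ = s := by tauto
  rcases h2 with rfl | rfl <;> rcases h3 with rfl | rfl
  · exact fiveSum_le_of_eq_fourth h rfl d01 hr0 h40 hr1 h41 hr4
  · exact hrs
  · exact hsr
  · exact fiveSum_le_of_eq_fourth h rfl d01 hs0 h40 hs1 h41 hs4

theorem fiveSum_square_le {a b c d : ℝ} (h : IsMassTuple m w₀ w₁ w₂ w₃ w₄)
    (ha : 0 ≤ a) (ha1 : a ≤ 1) (hb : 0 ≤ b) (hb1 : b ≤ 1)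
    (hc : 0 ≤ c) (hc1 : c ≤ 1) (hd : 0 ≤ d) (hd1 : d ≤ 1)
    (h40 : planeDet (1, 0) p₄ ^ 2 ≤ 1) (h41 : planeDet (0, 1) p₄ ^ 2 ≤ 1)
    (h4 : planeDet (1, 1) p₄ ^ 2 ≤ 1) :
    fiveSum w₀ w₁ w₂ w₃ w₄ (1, 0) (0, 1) (a, b) (c, d) p₄ ≤ 2 / 9 := by
  have v {p₂ p₃ : ℝ × ℝ} (h2 : p₂ = 0 ∨ p₂ = (1, 0) ∨ p₂ = (0, 1) ∨ p₂ = (1, 1) ∨ p₂ = (1, 1))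
      (h3 : p₃ = 0 ∨ p₃ = (1, 0) ∨ p₃ = (0, 1) ∨ p₃ = (1, 1) ∨ p₃ = (1, 1)) :
      fiveSum w₀ w₁ w₂ w₃ w₄ (1, 0) (0, 1) p₂ p₃ p₄ ≤ 2 / 9 := by
    have e : fiveSum w₀ w₁ w₂ w₃ w₄ (1, 0) (0, 1) (1, 1) (1, 1) p₄ ≤ 2 / 9 :=
      fiveSum_le_of_eq_fourth h rfl (by simp [planeDet]) (by simp [planeDet]) h40
        (by simp [planeDet]) h41 h4
    exact fiveSum_vertices_le h (by simp [planeDet]) (by simp [planeDet]) (by simp [planeDet])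
      (by simp [planeDet]) h40 h41 h4 h4 e e h2 h3
  have step {p₃ : ℝ × ℝ} (h3 : p₃ = 0 ∨ p₃ = (1, 0) ∨ p₃ = (0, 1) ∨ p₃ = (1, 1) ∨ p₃ = (1, 1)) :
      fiveSum w₀ w₁ w₂ w₃ w₄ (1, 0) (0, 1) (a, b) p₃ p₄ ≤ 2 / 9 :=
    (segmentBounded_fiveSum h _).le_of_mem_square ha ha1 hb hb1
      (v (.inl rfl) h3) (v (.inr (.inl rfl)) h3) (v (.inr (.inr (.inl rfl))) h3)
      (v (.inr (.inr (.inr (.inl rfl)))) h3)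
  rw [fiveSum_swap23]
  refine (segmentBounded_fiveSum h.swap23 _).le_of_mem_square hc hc1 hd hd1 ?_ ?_ ?_ ?_ <;>
  · rw [fiveSum_swap23]
    exact step (by simp)

theorem fiveSum_opposite_le {a b c d e f : ℝ} (h : IsMassTuple m w₀ w₁ w₂ w₃ w₄)
    (ha : 0 ≤ a) (ha1 : a ≤ 1) (hb : 0 ≤ b) (hb1 : b ≤ 1)
    (hc : 0 ≤ c) (hc1 : c ≤ 1) (hd : 0 ≤ d) (hd1 : d ≤ 1)
    (he : 0 ≤ e) (he1 : e ≤ 1) (hf : 0 ≤ f) (hf1 : f ≤ 1)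
    (h2 : a * f + b * e ≤ 1) (h3 : c * f + d * e ≤ 1) :
    fiveSum w₀ w₁ w₂ w₃ w₄ (1, 0) (0, 1) (a, b) (c, d) (e, -f) ≤ 2 / 9 := by
  have h40 : planeDet (1, 0) (e, -f) ^ 2 ≤ 1 := by
    simp only [planeDet]; nlinarith
  have h41 : planeDet (0, 1) (e, -f) ^ 2 ≤ 1 := by
    simp only [planeDet]; nlinarith
  -- The determinant of `(1, 1)` and `(e, -f)` is `-(e + f)`, so this decides whether the corner of
  -- the square is admissible or cut off.
  rcases le_or_gt (e + f) 1 with hef | hef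
  · refine fiveSum_square_le h ha ha1 hb hb1 hc hc1 hd hd1 h40 h41 ?_
    simp only [planeDet]; nlinarith
  have he0 : 0 < e := by linarith
  have hf0 : 0 < f := by linarith
  obtain ⟨t, ht⟩ : ∃ t, t = (1 - f) / e := ⟨_, rfl⟩
  obtain ⟨u, hu⟩ : ∃ u, u = (1 - e) / f := ⟨_, rfl⟩
  have e1 : t * e + f = 1 := by rw [ht]; field_simp; ring
  have e2 : u * f + e = 1 := by rw [hu]; field_simp; ring
  have ht0 : 0 ≤ t := by rw [ht]; exact div_nonneg (by linarith) he
  have hu0 : 0 ≤ u := by rw [hu]; exact div_nonneg (by linarith) hf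
  have ht1 : t < 1 := by rw [ht, div_lt_one he0]; linarith
  have hu1 : u < 1 := by rw [hu, div_lt_one hf0]; linarith
  have k1 := fiveSum_pentagon_le h ht0 ht1.le hu0 hu1.le he he1 hf hf1 e1 e2
  have k2 := fiveSum_pentagon_le h.swap23 ht0 ht1.le hu0 hu1.le he he1 hf hf1 e1 e2
  rw [fiveSum_swap23] at k2
  have v {p₂ p₃ : ℝ × ℝ} (h2 : p₂ = 0 ∨ p₂ = (1, 0) ∨ p₂ = (0, 1) ∨ p₂ = (1, t) ∨ p₂ = (u, 1))
      (h3 : p₃ = 0 ∨ p₃ = (1, 0) ∨ p₃ = (0, 1) ∨ p₃ = (1, t) ∨ p₃ = (u, 1)) :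
      fiveSum w₀ w₁ w₂ w₃ w₄ (1, 0) (0, 1) p₂ p₃ (e, -f) ≤ 2 / 9 := by
    refine fiveSum_vertices_le h ?_ ?_ ?_ ?_ h40 h41 ?_ ?_ k1 k2 h2 h3
    · simp only [planeDet]; nlinarith
    · simp [planeDet]
    · simp [planeDet]
    · simp only [planeDet]; nlinarith
    · have : planeDet (1, t) (e, -f) = -1 := by simp only [planeDet]; linarith
      simp [this]
    · have : planeDet (u, 1) (e, -f) = -1 := by simp only [planeDet]; linarith
      simp [this]
  have step {p₃ : ℝ × ℝ} (h3 : p₃ = 0 ∨ p₃ = (1, 0) ∨ p₃ = (0, 1) ∨ p₃ = (1, t) ∨ p₃ = (u, 1)) :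
      fiveSum w₀ w₁ w₂ w₃ w₄ (1, 0) (0, 1) (a, b) p₃ (e, -f) ≤ 2 / 9 :=
    (segmentBounded_fiveSum h _).le_of_mem_pentagon ha ha1 hb hb1 ht0 ht1 hf0 e1 e2 h2
      (v (.inl rfl) h3) (v (.inr (.inl rfl)) h3) (v (.inr (.inr (.inl rfl))) h3)
      (v (.inr (.inr (.inr (.inl rfl)))) h3) (v (.inr (.inr (.inr (.inr rfl)))) h3)
  rw [fiveSum_swap23]
  refine (segmentBounded_fiveSum h.swap23 _).le_of_mem_pentagon hc hc1 hd hd1 ht0 ht1 hf0 e1 e2 h3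
    ?_ ?_ ?_ ?_ ?_ <;>
  · rw [fiveSum_swap23]
    exact step (by simp)

/-- If `f ≥ 0`, the determinant of `(1, 1)` with `(e, f)` is `f - e`, of absolute value at most 1,
so the whole square is admissible. If `f ≤ 0`, the fifth vector lies in the adjacent quadrant. -/
theorem fiveSum_two_quadrants_le {a b c d e f : ℝ} (h : IsMassTuple m w₀ w₁ w₂ w₃ w₄)
    (ha : 0 ≤ a) (ha1 : a ≤ 1) (hb : 0 ≤ b) (hb1 : b ≤ 1)
    (hc : 0 ≤ c) (hc1 : c ≤ 1) (hd : 0 ≤ d) (hd1 : d ≤ 1)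
    (he : 0 ≤ e) (he1 : e ≤ 1) (hf : |f| ≤ 1)
    (h2 : |planeDet (a, b) (e, f)| ≤ 1) (h3 : |planeDet (c, d) (e, f)| ≤ 1) :
    fiveSum w₀ w₁ w₂ w₃ w₄ (1, 0) (0, 1) (a, b) (c, d) (e, f) ≤ 2 / 9 := by
  rw [abs_le] at hf h2 h3
  simp only [planeDet] at h2 h3
  rcases le_total 0 f with hf0 | hf0
  · apply fiveSum_square_le h ha ha1 hb hb1 hc hc1 hd hd1 <;> simp only [planeDet] <;> nlinarith
  · have := fiveSum_opposite_le h ha ha1 hb hb1 hc hc1 hd hd1 he he1 (neg_nonneg.2 hf0)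
      (by linarith) (by linarith) (by linarith)
    rwa [neg_neg] at this

/-- All first coordinates nonnegative. -/
theorem fiveSum_halfplane_le {a b c d e f : ℝ} (h : IsMassTuple m w₀ w₁ w₂ w₃ w₄)
    (ha : 0 ≤ a) (ha1 : a ≤ 1) (hb : |b| ≤ 1)
    (hc : 0 ≤ c) (hc1 : c ≤ 1) (hd : |d| ≤ 1)
    (he : 0 ≤ e) (he1 : e ≤ 1) (hf : |f| ≤ 1)
    (h23 : |planeDet (a, b) (c, d)| ≤ 1)
    (h24 : |planeDet (a, b) (e, f)| ≤ 1) (h34 : |planeDet (c, d) (e, f)| ≤ 1) :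
    fiveSum w₀ w₁ w₂ w₃ w₄ (1, 0) (0, 1) (a, b) (c, d) (e, f) ≤ 2 / 9 := by
  have flip (x y : ℝ) (p : ℝ × ℝ) : planeDet (x, -y) (p.1, -p.2) = -planeDet (x, y) p := by
    simp only [planeDet]; ring
  have flip' : fiveSum w₀ w₁ w₂ w₃ w₄ (1, 0) (0, 1) (a, b) (c, d) (e, f) =
      fiveSum w₀ w₁ w₂ w₃ w₄ (1, 0) (0, 1) (a, -b) (c, -d) (e, -f) := by
    simp only [fiveSum, planeDet]; ring
  have comm (p q : ℝ × ℝ) : |planeDet p q| = |planeDet q p| := by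
    rw [← abs_neg]; congr 1; simp only [planeDet]; ring
  have hb' := abs_le.1 hb
  have hd' := abs_le.1 hd
  have hf' := abs_le.1 hf
  have k24 : |planeDet (a, -b) (e, -f)| ≤ 1 := by rw [flip a b (e, f), abs_neg]; exact h24
  have k34 : |planeDet (c, -d) (e, -f)| ≤ 1 := by rw [flip c d (e, f), abs_neg]; exact h34
  have k23 : |planeDet (a, -b) (c, -d)| ≤ 1 := by rw [flip a b (c, d), abs_neg]; exact h23
  have nb : |(-b)| ≤ 1 := by rwa [abs_neg]
  have nd : |(-d)| ≤ 1 := by rwa [abs_neg]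
  have nf : |(-f)| ≤ 1 := by rwa [abs_neg]
  -- Two of the three second coordinates share a sign. Permuting, and reflecting in the first axis
  -- if needed, puts those two vectors in the positive quadrant.
  rcases le_total 0 b with b0 | b0 <;> rcases le_total 0 d with d0 | d0
  · exact fiveSum_two_quadrants_le h ha ha1 b0 hb'.2 hc hc1 d0 hd'.2 he he1 hf h24 h34
  · rcases le_total 0 f with f0 | f0
    · rw [fiveSum_swap34]
      exact fiveSum_two_quadrants_le h.swap34 ha ha1 b0 hb'.2 he he1 f0 hf'.2 hc hc1 hd h23
        (by rwa [comm])
    · rw [flip', fiveSum_swap34, fiveSum_swap23, fiveSum_swap34]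
      exact fiveSum_two_quadrants_le h.swap34.swap23.swap34 he he1 (by linarith) (by linarith)
        hc hc1 (by linarith) (by linarith) ha ha1 nb (by rwa [comm]) (by rwa [comm])
  · rcases le_total 0 f with f0 | f0
    · rw [fiveSum_swap34, fiveSum_swap23, fiveSum_swap34]
      exact fiveSum_two_quadrants_le h.swap34.swap23.swap34 he he1 (by linarith) (by linarith)
        hc hc1 (by linarith) (by linarith) ha ha1 hb (by rwa [comm]) (by rwa [comm])
    · rw [flip', fiveSum_swap34]
      exact fiveSum_two_quadrants_le h.swap34 ha ha1 (by linarith) (by linarith) he he1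
        (by linarith) (by linarith) hc hc1 nd k23 (by rwa [comm])
  · rw [flip']
    exact fiveSum_two_quadrants_le h ha ha1 (by linarith) (by linarith) hc hc1 (by linarith)
      (by linarith) he he1 nf k24 k34

theorem exists_sign_fst_nonneg (p : ℝ × ℝ) : ∃ s : ℝ, (s = 1 ∨ s = -1) ∧ 0 ≤ s * p.1 := by
  rcases le_total 0 p.1 with h | h
  · exact ⟨1, .inl rfl, by linarith⟩
  · exact ⟨-1, .inr rfl, by linarith⟩

/-- Five vectors with determinants at most one, the first two being the standard basis. -/
theorem fiveSum_le (h : IsMassTuple m w₀ w₁ w₂ w₃ w₄)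
    (d02 : |planeDet (1, 0) p₂| ≤ 1) (d03 : |planeDet (1, 0) p₃| ≤ 1)
    (d04 : |planeDet (1, 0) p₄| ≤ 1) (d12 : |planeDet (0, 1) p₂| ≤ 1)
    (d13 : |planeDet (0, 1) p₃| ≤ 1) (d14 : |planeDet (0, 1) p₄| ≤ 1)
    (d23 : |planeDet p₂ p₃| ≤ 1) (d24 : |planeDet p₂ p₄| ≤ 1) (d34 : |planeDet p₃ p₄| ≤ 1) :
    fiveSum w₀ w₁ w₂ w₃ w₄ (1, 0) (0, 1) p₂ p₃ p₄ ≤ 2 / 9 := by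
  obtain ⟨r, hr, hr0⟩ := exists_sign_fst_nonneg p₂
  obtain ⟨s, hs, hs0⟩ := exists_sign_fst_nonneg p₃
  obtain ⟨t, ht, ht0⟩ := exists_sign_fst_nonneg p₄
  have one {r : ℝ} (hr : r = 1 ∨ r = -1) : |r| = 1 := by rcases hr with rfl | rfl <;> simp
  have onesq {r : ℝ} (hr : r = 1 ∨ r = -1) : r ^ 2 = 1 := by rcases hr with rfl | rfl <;> simp
  have scale (r s : ℝ) (p q : ℝ × ℝ) :
      planeDet (r * p.1, r * p.2) (s * q.1, s * q.2) = r * s * planeDet p q := by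
    simp only [planeDet]; ring
  have scale1 (s : ℝ) (p q : ℝ × ℝ) : planeDet p (s * q.1, s * q.2) = s * planeDet p q := by
    simp only [planeDet]; ring
  have e : fiveSum w₀ w₁ w₂ w₃ w₄ (1, 0) (0, 1) p₂ p₃ p₄ = fiveSum w₀ w₁ w₂ w₃ w₄ (1, 0) (0, 1)
      (r * p₂.1, r * p₂.2) (s * p₃.1, s * p₃.2) (t * p₄.1, t * p₄.2) := by
    simp only [fiveSum, scale, scale1, mul_pow, onesq hr, onesq hs, onesq ht, one_mul]
  have cx (p : ℝ × ℝ) : |planeDet (0, 1) p| = |p.1| := by simp [planeDet]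
  have cy (p : ℝ × ℝ) : |planeDet (1, 0) p| = |p.2| := by simp [planeDet]
  rw [cx] at d12 d13 d14
  rw [cy] at d02 d03 d04
  have ab {r x : ℝ} (hr : r = 1 ∨ r = -1) (hx : |x| ≤ 1) : |r * x| ≤ 1 := by
    rwa [abs_mul, one hr, one_mul]
  have ab2 {r s x : ℝ} (hr : r = 1 ∨ r = -1) (hs : s = 1 ∨ s = -1) (hx : |x| ≤ 1) :
      |r * s * x| ≤ 1 := by
    rwa [abs_mul, abs_mul, one hr, one hs, one_mul, one_mul]
  rw [e]
  apply fiveSum_halfplane_le h hr0 (abs_le.1 (ab hr d12)).2 (ab hr d02) hs0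
    (abs_le.1 (ab hs d13)).2 (ab hs d03) ht0 (abs_le.1 (ab ht d14)).2 (ab ht d04)
  · rw [scale]; exact ab2 hr hs d23
  · rw [scale]; exact ab2 hr ht d24
  · rw [scale]; exact ab2 hs ht d34

end FiveVectors

/-- Five weighted vectors of the plane: the weighted sum of squared determinants is controlled by the
largest squared determinant. -/
theorem exists_planeDet_sq_ge {m : ℝ} (hm : 1 / 6 ≤ m) (w : Fin 5 → ℝ) (h0 : ∀ i, 0 ≤ w i)
    (h1 : ∀ i, w i ≤ m) (hs : ∑ i, w i + m = 1) (p : Fin 5 → ℝ × ℝ) :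
    ∃ j k, ∑ i, ∑ l, w i * w l * planeDet (p i) (p l) ^ 2 ≤ 4 / 9 * planeDet (p j) (p k) ^ 2 := by
  obtain ⟨⟨j, k⟩, hmax⟩ :=
    Finite.exists_max (fun x : Fin 5 × Fin 5 ↦ planeDet (p x.1) (p x.2) ^ 2)
  refine ⟨j, k, ?_⟩
  have hmax' (i l) : planeDet (p i) (p l) ^ 2 ≤ planeDet (p j) (p k) ^ 2 := hmax (i, l)
  by_cases hD : planeDet (p j) (p k) = 0
  · have this (i l) : planeDet (p i) (p l) ^ 2 = 0 :=
      le_antisymm (by simpa [hD] using hmax' i l) (sq_nonneg _)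
    simp [this]
  have hjk : j ≠ k := by
    rintro rfl
    exact hD (planeDet_self _)
  obtain ⟨σ, hσ0, hσ1⟩ : ∃ σ : Equiv.Perm (Fin 5), σ 0 = j ∧ σ 1 = k := by
    refine ⟨Equiv.swap 0 j * Equiv.swap 1 (Equiv.swap 0 j k), ?_, ?_⟩ <;> clear * - hjk <;>
      revert j k <;> decide
  -- Cramer coordinates in the basis `p j`, `p k`; every determinant is divided by the maximal one.
  obtain ⟨q, hq⟩ : ∃ q : Fin 5 → ℝ × ℝ, q = fun i ↦ (planeDet (p (σ i)) (p k) /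
    planeDet (p j) (p k), planeDet (p j) (p (σ i)) / planeDet (p j) (p k)) := ⟨_, rfl⟩
  have hqd (i l) : planeDet (q i) (q l) = planeDet (p (σ i)) (p (σ l)) / planeDet (p j) (p k) := by
    have h : planeDet (p (σ i)) (p k) * planeDet (p j) (p (σ l)) -
        planeDet (p j) (p (σ i)) * planeDet (p (σ l)) (p k) =
        planeDet (p (σ i)) (p (σ l)) * planeDet (p j) (p k) := by
      simp only [planeDet]; ring
    rw [planeDet, hq, div_mul_div_comm, div_mul_div_comm, ← sub_div, h, mul_div_mul_right _ _ hD]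
  have hq0 : q 0 = (1, 0) := by simp [hq, hσ0, planeDet_self, hD]
  have hq1 : q 1 = (0, 1) := by simp [hq, hσ1, planeDet_self, hD]
  have hle (i l) : |planeDet (q i) (q l)| ≤ 1 := by
    rw [← planeDet_sq_le_one_iff, hqd, div_pow, div_le_one (by positivity)]
    exact hmax' _ _
  have hmass : IsMassTuple m (w (σ 0)) (w (σ 1)) (w (σ 2)) (w (σ 3)) (w (σ 4)) := by
    refine ⟨hm, h0 _, h0 _, h0 _, h0 _, h0 _, h1 _, h1 _, h1 _, h1 _, h1 _, ?_⟩
    rw [← hs, ← Equiv.sum_comp σ, Fin.sum_univ_five]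
  have key := fiveSum_le hmass (p₂ := q 2) (p₃ := q 3) (p₄ := q 4) (hq0 ▸ hle 0 2) (hq0 ▸ hle 0 3)
    (hq0 ▸ hle 0 4) (hq1 ▸ hle 1 2) (hq1 ▸ hle 1 3) (hq1 ▸ hle 1 4) (hle 2 3) (hle 2 4) (hle 3 4)
  rw [← hq0, ← hq1] at key
  have e : ∑ i, ∑ l, w i * w l * planeDet (p i) (p l) ^ 2 =
      planeDet (p j) (p k) ^ 2 * (2 * fiveSum (w (σ 0)) (w (σ 1)) (w (σ 2)) (w (σ 3)) (w (σ 4))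
        (q 0) (q 1) (q 2) (q 3) (q 4)) := by
    have e1 (i l) : w (σ i) * w (σ l) * planeDet (p (σ i)) (p (σ l)) ^ 2 =
        planeDet (p j) (p k) ^ 2 * (w (σ i) * w (σ l) * planeDet (q i) (q l) ^ 2) := by
      rw [hqd]; field_simp
    rw [← Equiv.sum_comp σ]
    simp_rw [← Equiv.sum_comp σ (fun l ↦ w _ * w l * planeDet (p _) (p l) ^ 2), e1,
      ← Finset.mul_sum]
    congr 1
    simp only [Fin.sum_univ_five, fiveSum, planeDet_self]
    rw [planeDet_swap_sq (q 1) (q 0), planeDet_swap_sq (q 2) (q 0), planeDet_swap_sq (q 2) (q 1),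
      planeDet_swap_sq (q 3) (q 0), planeDet_swap_sq (q 3) (q 1), planeDet_swap_sq (q 3) (q 2),
      planeDet_swap_sq (q 4) (q 0), planeDet_swap_sq (q 4) (q 1), planeDet_swap_sq (q 4) (q 2),
      planeDet_swap_sq (q 4) (q 3)]
    ring
  rw [e]
  have := mul_le_mul_of_nonneg_left key (sq_nonneg (planeDet (p j) (p k)))
  linarith

/-! ### Determinants in isotropic systems -/

/-- The determinant of three vectors of `ℝ³`. -/
def tripleDet (x y z : Fin 3 → ℝ) : ℝ := (Matrix.of ![x, y, z]).det

theorem tripleDet_eq (x y z : Fin 3 → ℝ) : tripleDet x y z =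
    (x 1 * y 2 - x 2 * y 1) * z 0 + (x 2 * y 0 - x 0 * y 2) * z 1 +
      (x 0 * y 1 - x 1 * y 0) * z 2 := by
  simp [tripleDet, Matrix.det_fin_three]; ring

/-- The alternating form `tripleDet a` has `a` in its kernel, so it lives on the quotient plane. The
coordinates use a nonzero entry of `a` as denominator. -/
theorem exists_planeDet_eq_tripleDet {a : Fin 3 → ℝ} (ha : a ≠ 0) :
    ∃ π : (Fin 3 → ℝ) → ℝ × ℝ, ∀ x y, tripleDet a x y = planeDet (π x) (π y) := by
  simp only [tripleDet_eq, planeDet]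
  by_cases h0 : a 0 = 0
  · by_cases h1 : a 1 = 0
    · have h2 : a 2 ≠ 0 := by
        intro h2
        apply ha
        ext i
        fin_cases i <;> assumption
      refine ⟨fun p ↦ (a 2 * p 0 - a 0 * p 2, p 1 - a 1 * p 2 / a 2), fun x y ↦ ?_⟩
      field_simp
      ring
    · refine ⟨fun p ↦ (a 1 * p 2 - a 2 * p 1, p 0 - a 0 * p 1 / a 1), fun x y ↦ ?_⟩
      field_simp
      ring
  · refine ⟨fun p ↦ (a 0 * p 1 - a 1 * p 0, p 2 - a 2 * p 0 / a 0), fun x y ↦ ?_⟩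
    field_simp
    ring

section Isotropic

variable {ι : Type*} [Fintype ι] {c : ι → ℝ} {u : ι → Fin 3 → ℝ}

theorem sum_mul_sq_of_isotropic
    (hI : ∀ r s, ∑ i, c i * (u i r * u i s) = if r = s then 1 / 3 else 0) (x y z : ℝ) :
    ∑ i, c i * (x * u i 0 + y * u i 1 + z * u i 2) ^ 2 = (x ^ 2 + y ^ 2 + z ^ 2) / 3 := by
  have e (i : ι) : c i * (x * u i 0 + y * u i 1 + z * u i 2) ^ 2 =
      x ^ 2 * (c i * (u i 0 * u i 0)) + y ^ 2 * (c i * (u i 1 * u i 1)) +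
      z ^ 2 * (c i * (u i 2 * u i 2)) + 2 * x * y * (c i * (u i 0 * u i 1)) +
      2 * x * z * (c i * (u i 0 * u i 2)) + 2 * y * z * (c i * (u i 1 * u i 2)) := by ring
  simp_rw [e, Finset.sum_add_distrib, ← Finset.mul_sum, hI]
  simp
  ring

/-- In an isotropic system of unit vectors, the squared determinants with a fixed member have
weighted sum `2 / 9`. -/
theorem sum_sum_tripleDet_sq (hc : ∑ i, c i = 1)
    (hI : ∀ r s, ∑ i, c i * (u i r * u i s) = if r = s then 1 / 3 else 0)
    (hu : ∀ i, u i 0 ^ 2 + u i 1 ^ 2 + u i 2 ^ 2 = 1) (a : ι) :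
    ∑ j, ∑ k, c j * c k * tripleDet (u a) (u j) (u k) ^ 2 = 2 / 9 := by
  -- Isotropy turns the sum over `k` into `c j * |u a × u j|² / 3`, and Lagrange's identity gives
  -- `|u a × u j|² = 1 - ⟨u a, u j⟩²`. Summing over `j` gives `(1 - 1/3) / 3`.
  have e (j : ι) : ∑ k, c j * c k * tripleDet (u a) (u j) (u k) ^ 2 =
      1 / 3 * c j - 1 / 3 * (c j * (u a 0 * u j 0 + u a 1 * u j 1 + u a 2 * u j 2) ^ 2) := by
    simp_rw [mul_assoc (c j), ← Finset.mul_sum, tripleDet_eq]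
    rw [sum_mul_sq_of_isotropic hI]
    linear_combination c j / 3 * (u j 0 ^ 2 + u j 1 ^ 2 + u j 2 ^ 2) * hu a + c j / 3 * hu j
  simp_rw [e, Finset.sum_sub_distrib, ← Finset.mul_sum]
  rw [sum_mul_sq_of_isotropic hI, hc, hu a]
  norm_num

end Isotropic

/-- An isotropic system of six weighted unit vectors in `ℝ³` contains three vectors whose squared
determinant is at least `1 / 2`. -/
theorem exists_tripleDet_sq_ge {c : Fin 6 → ℝ} {u : Fin 6 → Fin 3 → ℝ} (h0 : ∀ i, 0 ≤ c i)
    (hc : ∑ i, c i = 1)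
    (hI : ∀ r s, ∑ i, c i * (u i r * u i s) = if r = s then 1 / 3 else 0)
    (hu : ∀ i, u i 0 ^ 2 + u i 1 ^ 2 + u i 2 ^ 2 = 1) :
    ∃ i j k, 1 / 2 ≤ tripleDet (u i) (u j) (u k) ^ 2 := by
  obtain ⟨a, ha⟩ := Finite.exists_max c
  have ha6 : 1 / 6 ≤ c a := by
    have := Finset.sum_le_card_nsmul Finset.univ c (c a) (fun i _ ↦ ha i)
    simp [hc] at this
    linarith
  have hne : u a ≠ 0 := by
    intro h
    have := hu a
    simp [h] at this
  obtain ⟨π, hπ⟩ := exists_planeDet_eq_tripleDet hne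
  have hsum := sum_sum_tripleDet_sq hc hI hu a
  have z1 (x) : tripleDet (u a) (u a) x = 0 := by rw [tripleDet_eq]; ring
  have z2 (x) : tripleDet (u a) x (u a) = 0 := by rw [tripleDet_eq]; ring
  simp_rw [Fin.sum_univ_succAbove _ a, z1, z2] at hsum
  rw [Fin.sum_univ_succAbove _ a] at hc
  obtain ⟨j, k, hjk⟩ := exists_planeDet_sq_ge ha6 (fun i ↦ c (a.succAbove i)) (fun i ↦ h0 _)
    (fun i ↦ ha _) (by linarith) (fun i ↦ π (u (a.succAbove i)))
  refine ⟨a, a.succAbove j, a.succAbove k, ?_⟩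
  simp only [← hπ] at hjk
  simp at hsum
  rw [hsum] at hjk
  linarith

/-! ### Extremal position and John's decomposition -/

/-- The squared Euclidean norm on `ℝ³`. -/
def normSq3 (x : Fin 3 → ℝ) : ℝ := x 0 ^ 2 + x 1 ^ 2 + x 2 ^ 2

theorem continuous_normSq3 : Continuous normSq3 := by
  unfold normSq3; fun_prop

theorem exists_pos_mul_le {A b : ℝ} (hA : 0 ≤ A) (hb : 0 < b) :
    ∃ ε : ℝ, 0 < ε ∧ ε ≤ 1 ∧ ε * (A + 1) ≤ b := by
  refine ⟨min 1 (b / (A + 1)), by positivity, min_le_left _ _, ?_⟩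
  calc min 1 (b / (A + 1)) * (A + 1) ≤ b / (A + 1) * (A + 1) := by gcongr; exact min_le_right _ _
    _ = b := by field_simp

theorem det_one_add_smul (H : Matrix (Fin 3) (Fin 3) ℝ) :
    ∃ e : ℝ, ∀ ε : ℝ, (1 + ε • H).det = 1 + ε * H.trace + ε ^ 2 * e + ε ^ 3 * H.det := by
  refine ⟨H 0 0 * H 1 1 - H 0 1 * H 1 0 + H 0 0 * H 2 2 - H 0 2 * H 2 0 + H 1 1 * H 2 2 -
    H 1 2 * H 2 1, fun ε ↦ ?_⟩
  simp [Matrix.det_fin_three, Matrix.trace, Fin.sum_univ_three]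
  ring

/-- A matrix of positive trace whose quadratic form is negative on the unit vectors of a compact
subset of the unit ball yields a linear map of determinant greater than one that keeps this subset
in the unit ball. -/
theorem exists_det_gt_one {S : Set (Fin 3 → ℝ)} (hS : IsCompact S) (hS1 : ∀ s ∈ S, normSq3 s ≤ 1)
    {H : Matrix (Fin 3) (Fin 3) ℝ} {γ : ℝ} (hγ : 0 < γ) (htr : 0 < H.trace)
    (hH : ∀ s ∈ S, normSq3 s = 1 → s ⬝ᵥ H.mulVec s < -γ) :
    ∃ R : Matrix (Fin 3) (Fin 3) ℝ, 1 < R.det ∧ ∀ s ∈ S, normSq3 (R.mulVec s) ≤ 1 := by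
  have cq : Continuous fun s : Fin 3 → ℝ ↦ s ⬝ᵥ H.mulVec s := by fun_prop
  have cn : Continuous fun s : Fin 3 → ℝ ↦ normSq3 (H.mulVec s) := by
    unfold normSq3; fun_prop
  obtain ⟨M₁, hM₁⟩ := hS.exists_bound_of_continuousOn cq.continuousOn
  obtain ⟨M₂, hM₂⟩ := hS.exists_bound_of_continuousOn cn.continuousOn
  obtain ⟨M, hM0, hq, hn⟩ : ∃ M : ℝ, 0 ≤ M ∧ (∀ s ∈ S, s ⬝ᵥ H.mulVec s ≤ M) ∧
      ∀ s ∈ S, normSq3 (H.mulVec s) ≤ M := by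
    refine ⟨max 0 (max M₁ M₂), le_max_left _ _, fun s hs ↦ ?_, fun s hs ↦ ?_⟩
    · exact (le_abs_self _).trans ((hM₁ s hs).trans (by simp))
    · exact (le_abs_self _).trans ((hM₂ s hs).trans (by simp))
  -- By compactness, points of `S` where the form is not below `-γ` stay a fixed distance inside the
  -- ball. They absorb a small perturbation, while elsewhere the first-order term of `1 + ε • H`
  -- wins.
  obtain ⟨κ, hκ, hSκ⟩ : ∃ κ > 0, ∀ s ∈ S, -γ ≤ s ⬝ᵥ H.mulVec s → normSq3 s ≤ 1 - κ := by
    have hc : IsCompact (S ∩ {s | -γ ≤ s ⬝ᵥ H.mulVec s}) :=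
      hS.inter_right (isClosed_le continuous_const cq)
    rcases (S ∩ {s | -γ ≤ s ⬝ᵥ H.mulVec s}).eq_empty_or_nonempty with he | he
    · refine ⟨1, one_pos, fun s hs h ↦ ?_⟩
      have : s ∈ S ∩ {s | -γ ≤ s ⬝ᵥ H.mulVec s} := ⟨hs, h⟩
      simp [he] at this
    · obtain ⟨x, hx, hmax⟩ := hc.exists_isMaxOn he continuous_normSq3.continuousOn
      refine ⟨1 - normSq3 x, ?_, fun s hs h ↦ by simpa using hmax ⟨hs, h⟩⟩
      have h1 := hS1 x hx.1
      rcases h1.lt_or_eq with h | h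
      · linarith
      · exact absurd (hH x hx.1 h) (not_lt.2 hx.2)
  obtain ⟨e, he⟩ := det_one_add_smul H
  obtain ⟨ε, hε, hε1, hεb⟩ := exists_pos_mul_le (A := 3 * M + |e| + |H.det|) (by positivity)
    (lt_min hκ (lt_min hγ htr))
  have b1 := hεb.trans (min_le_left _ _)
  have b2 := hεb.trans ((min_le_right _ _).trans (min_le_left _ _))
  have b3 := hεb.trans ((min_le_right _ _).trans (min_le_right _ _))
  have p1 : 0 ≤ ε * |e| := by positivity
  have p2 : 0 ≤ ε * |H.det| := by positivity
  have p3 : 0 ≤ ε * M := by positivity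
  have hε2 : ε ^ 2 ≤ ε := by nlinarith
  refine ⟨1 + ε • H, ?_, fun s hs ↦ ?_⟩
  · rw [he]
    have q1 : -(ε * |e|) ≤ ε * e := by
      rw [← mul_neg]; exact mul_le_mul_of_nonneg_left (neg_abs_le e) hε.le
    have q2 : -(ε * |H.det|) ≤ ε ^ 2 * H.det := by
      calc -(ε * |H.det|) ≤ -(ε ^ 2 * |H.det|) := by
            have := mul_le_mul_of_nonneg_right hε2 (abs_nonneg H.det); linarith
        _ = ε ^ 2 * -|H.det| := by ring
        _ ≤ _ := mul_le_mul_of_nonneg_left (neg_abs_le _) (by positivity)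
    have : 0 < ε * (H.trace + ε * e + ε ^ 2 * H.det) := mul_pos hε (by linarith)
    linarith
  · have hexp : normSq3 ((1 + ε • H).mulVec s) =
        normSq3 s + 2 * ε * (s ⬝ᵥ H.mulVec s) + ε ^ 2 * normSq3 (H.mulVec s) := by
      simp [normSq3, Matrix.add_mulVec, Matrix.smul_mulVec, dotProduct, Fin.sum_univ_three]
      ring
    have hn' : ε ^ 2 * normSq3 (H.mulVec s) ≤ ε ^ 2 * M :=
      mul_le_mul_of_nonneg_left (hn s hs) (by positivity)
    have hn2 : ε ^ 2 * M ≤ ε * M := mul_le_mul_of_nonneg_right hε2 hM0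
    rw [hexp]
    rcases le_or_gt (-γ) (s ⬝ᵥ H.mulVec s) with h | h
    · have := hSκ s hs h
      have := mul_le_mul_of_nonneg_left (hq s hs) hε.le
      linarith
    · have h1 := hS1 s hs
      have := mul_le_mul_of_nonneg_left h.le hε.le
      have : ε * (ε * M) ≤ ε * γ := mul_le_mul_of_nonneg_left (by linarith) hε.le
      nlinarith

/-- Carathéodory's theorem with a fixed number of points. -/
theorem mem_convexHull_iff_exists_fin {E : Type*} [AddCommGroup E] [Module ℝ E]
    [FiniteDimensional ℝ E] {s : Set E} {x : E} {n : ℕ} (hn : Module.finrank ℝ E + 1 = n) :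
    x ∈ convexHull ℝ s ↔ ∃ c ∈ stdSimplex ℝ (Fin n), ∃ z : Fin n → E, (∀ i, z i ∈ s) ∧
      ∑ i, c i • z i = x := by
  constructor
  · intro hx
    obtain ⟨ι, _, z, w, hz, hind, hw, hw1, hsum⟩ := eq_pos_convex_span_of_mem_convexHull hx
    have hcard : Fintype.card ι ≤ Fintype.card (Fin n) := by
      have h1 := hind.card_le_finrank_succ
      have h2 := Submodule.finrank_le (vectorSpan ℝ (Set.range z))
      rw [Fintype.card_fin]
      lia
    obtain ⟨em⟩ := Function.Embedding.nonempty_of_card_le hcard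
    have hinj := em.injective
    obtain ⟨i₀⟩ : Nonempty ι := by
      by_contra h
      rw [not_nonempty_iff] at h
      simp at hw1
    refine ⟨Function.extend em w 0, ⟨fun i ↦ ?_, ?_⟩, Function.extend em z (fun _ ↦ z i₀),
      fun i ↦ ?_, ?_⟩
    · by_cases h : ∃ a, em a = i
      · obtain ⟨a, rfl⟩ := h
        rw [hinj.extend_apply]; exact (hw a).le
      · rw [Function.extend_apply' _ _ _ h]; rfl
    · rw [← hw1]
      refine (Fintype.sum_of_injective em hinj _ _ (fun i hi ↦ ?_) (fun i ↦ ?_)).symm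
      · rw [Function.extend_apply' _ _ _ (by simpa using hi)]; rfl
      · rw [hinj.extend_apply]
    · by_cases h : ∃ a, em a = i
      · obtain ⟨a, rfl⟩ := h
        rw [hinj.extend_apply]; exact hz ⟨a, rfl⟩
      · rw [Function.extend_apply' _ _ _ h]; exact hz ⟨i₀, rfl⟩
    · rw [← hsum]
      refine (Fintype.sum_of_injective em hinj _ _ (fun i hi ↦ ?_) (fun i ↦ ?_)).symm
      · rw [Function.extend_apply' _ _ _ (by simpa using hi)]; simp
      · rw [hinj.extend_apply, hinj.extend_apply]
  · rintro ⟨c, hc, z, hz, rfl⟩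
    exact (convex_convexHull ℝ s).sum_mem (fun i _ ↦ hc.1 i) hc.2
      (fun i _ ↦ subset_convexHull ℝ s (hz i))

theorem isCompact_convexHull_of_isCompact {E : Type*} [AddCommGroup E] [Module ℝ E]
    [TopologicalSpace E] [ContinuousAdd E] [ContinuousSMul ℝ E] [FiniteDimensional ℝ E]
    {s : Set E} (hs : IsCompact s) : IsCompact (convexHull ℝ s) := by
  have : convexHull ℝ s = (fun p : (Fin (Module.finrank ℝ E + 1) → ℝ) ×
      (Fin (Module.finrank ℝ E + 1) → E) ↦ ∑ i, p.1 i • p.2 i) ''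
      (stdSimplex ℝ (Fin (Module.finrank ℝ E + 1)) ×ˢ Set.pi Set.univ fun _ ↦ s) := by
    ext x
    rw [mem_convexHull_iff_exists_fin rfl]
    constructor
    · rintro ⟨c, hc, z, hz, rfl⟩
      exact ⟨(c, z), ⟨hc, fun i _ ↦ hz i⟩, rfl⟩
    · rintro ⟨⟨c, z⟩, ⟨hc, hz⟩, rfl⟩
      exact ⟨c, hc, z, fun i ↦ hz i (Set.mem_univ i), rfl⟩
  rw [this]
  refine IsCompact.image (IsCompact.prod ?_ (isCompact_univ_pi fun _ ↦ hs)) (by fun_prop)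
  exact isCompact_stdSimplex _ _

/-- Coordinates of `s sᵀ - I / 3` in the space of traceless symmetric matrices, for unit `s`. -/
noncomputable def tracelessSquare (s : Fin 3 → ℝ) : Fin 5 → ℝ :=
  ![s 0 ^ 2 - 1 / 3, s 1 ^ 2 - 1 / 3, s 0 * s 1, s 0 * s 2, s 1 * s 2]

theorem continuous_tracelessSquare : Continuous tracelessSquare := by
  unfold tracelessSquare
  refine continuous_pi fun i ↦ ?_
  fin_cases i <;> simp <;> fun_prop

/-- Otherwise a functional separates 0 from the hull, and it is a traceless quadratic form below
`-g` at all contact points. Adding `g / 2` times the identity makes the trace positive and keeps the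
form below `-g / 2` there; `exists_det_gt_one` then contradicts maximality. -/
theorem zero_mem_convexHull_tracelessSquare {S : Set (Fin 3 → ℝ)} (hS : IsCompact S)
    (hS1 : ∀ s ∈ S, normSq3 s ≤ 1)
    (hmax : ∀ R : Matrix (Fin 3) (Fin 3) ℝ, (∀ s ∈ S, normSq3 (R.mulVec s) ≤ 1) → R.det ≤ 1) :
    0 ∈ convexHull ℝ (tracelessSquare '' (S ∩ {s | normSq3 s = 1})) := by
  by_contra h0
  have hC : IsCompact (S ∩ {s | normSq3 s = 1}) :=
    hS.inter_right (isClosed_eq continuous_normSq3 continuous_const)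
  obtain ⟨f, g, hg0, hg⟩ := geometric_hahn_banach_point_closed (convex_convexHull ℝ _)
    (isCompact_convexHull_of_isCompact (hC.image continuous_tracelessSquare)).isClosed h0
  rw [map_zero] at hg0
  obtain ⟨k, hk⟩ : ∃ k : Fin 5 → ℝ, ∀ z, f z = -∑ i, z i * k i := by
    refine ⟨fun i ↦ -f (Pi.single i 1), fun z ↦ ?_⟩
    conv_lhs => rw [pi_eq_sum_univ' z]
    simp [map_sum]
  obtain ⟨H, hH⟩ : ∃ H : Matrix (Fin 3) (Fin 3) ℝ, H =
      !![k 0 - (k 0 + k 1) / 3 + g / 2, k 2 / 2, k 3 / 2;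
        k 2 / 2, k 1 - (k 0 + k 1) / 3 + g / 2, k 4 / 2;
        k 3 / 2, k 4 / 2, -(k 0 + k 1) / 3 + g / 2] := ⟨_, rfl⟩
  obtain ⟨R, hR, hRS⟩ := exists_det_gt_one (H := H) (γ := g / 2) hS hS1 (by linarith)
    (by rw [hH]; simp [Matrix.trace, Fin.sum_univ_three]; linarith) (fun s hs hs1 ↦ by
      have h := hg _ (subset_convexHull ℝ _ ⟨s, ⟨hs, hs1⟩, rfl⟩)
      rw [hk] at h
      simp [Fin.sum_univ_five, tracelessSquare] at h
      have e : s ⬝ᵥ H.mulVec s = (s 0 ^ 2 * k 0 + s 1 ^ 2 * k 1 + s 0 * s 1 * k 2 +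
          s 0 * s 2 * k 3 + s 1 * s 2 * k 4) + (g / 2 - (k 0 + k 1) / 3) * normSq3 s := by
        rw [hH]
        simp [dotProduct, Matrix.mulVec, Fin.sum_univ_three, normSq3]
        ring
      rw [e, hs1]
      linarith)
  exact absurd (hmax R hRS) (not_le.2 hR)

/-- John's decomposition of the identity for a compact set in extremal position. -/
theorem exists_isotropic_of_maximal {S : Set (Fin 3 → ℝ)} (hS : IsCompact S)
    (hS1 : ∀ s ∈ S, normSq3 s ≤ 1)
    (hmax : ∀ R : Matrix (Fin 3) (Fin 3) ℝ, (∀ s ∈ S, normSq3 (R.mulVec s) ≤ 1) → R.det ≤ 1) :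
    ∃ (c : Fin 6 → ℝ) (u : Fin 6 → Fin 3 → ℝ), (∀ i, 0 ≤ c i) ∧ ∑ i, c i = 1 ∧
      (∀ r s, ∑ i, c i * (u i r * u i s) = if r = s then 1 / 3 else 0) ∧
      (∀ i, normSq3 (u i) = 1) ∧ ∀ i, u i ∈ S := by
  -- Traceless symmetric matrices have dimension five, so Carathéodory needs six points.
  obtain ⟨w, ⟨hw, hw1⟩, z, hz, hsum⟩ := (mem_convexHull_iff_exists_fin (n := 6) (by simp)).1
    (zero_mem_convexHull_tracelessSquare hS hS1 hmax)
  choose v hv hvz using hz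
  have hv1 (i) : normSq3 (v i) = 1 := (hv i).2
  refine ⟨w, v, hw, hw1, ?_, hv1, fun i ↦ (hv i).1⟩
  intro r s
  have hc (j : Fin 5) : ∑ i, w i * tracelessSquare (v i) j = 0 := by
    have := congrFun hsum j
    simpa [Finset.sum_apply, hvz] using this
  have h0 := hc 0
  have h1 := hc 1
  have h01 := hc 2
  have h02 := hc 3
  have h12 := hc 4
  simp only [tracelessSquare, Matrix.cons_val, mul_sub, Finset.sum_sub_distrib, ← Finset.sum_mul,
    hw1, pow_two] at h0 h1 h01 h02 h12
  have h2 : ∑ i, w i * (v i 2 * v i 2) = 1 / 3 := by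
    have e (i) : w i * (v i 2 * v i 2) = w i - w i * (v i 0 * v i 0) - w i * (v i 1 * v i 1) := by
      have := hv1 i
      unfold normSq3 at this
      linear_combination w i * this
    simp_rw [e, Finset.sum_sub_distrib, hw1]
    linarith
  have h10 := h01
  have h20 := h02
  have h21 := h12
  simp_rw [mul_comm (v _ 0) (v _ 1)] at h10
  simp_rw [mul_comm (v _ 0) (v _ 2)] at h20
  simp_rw [mul_comm (v _ 1) (v _ 2)] at h21
  fin_cases r <;> fin_cases s <;> simp at * <;> linarith

theorem tripleDet_mulVec (M : Matrix (Fin 3) (Fin 3) ℝ) (x y z : Fin 3 → ℝ) :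
    tripleDet (M.mulVec x) (M.mulVec y) (M.mulVec z) = M.det * tripleDet x y z := by
  simp [tripleDet_eq, Matrix.det_fin_three, Matrix.mulVec, dotProduct, Fin.sum_univ_three]
  ring

theorem exists_max_det {S : Set (Fin 3 → ℝ)} (hS : IsCompact S) {δ : ℝ}
    (hδ : 0 < δ) (hSδ : ∀ i, Pi.single i δ ∈ S) :
    ∃ M : Matrix (Fin 3) (Fin 3) ℝ, 0 < M.det ∧ (∀ s ∈ S, normSq3 (M.mulVec s) ≤ 1) ∧
      ∀ R : Matrix (Fin 3) (Fin 3) ℝ, (∀ s ∈ S, normSq3 (R.mulVec s) ≤ 1) → R.det ≤ M.det := by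
  obtain ⟨F, hF⟩ : ∃ F : Set (Matrix (Fin 3) (Fin 3) ℝ),
      F = {M | ∀ s ∈ S, normSq3 (M.mulVec s) ≤ 1} := ⟨_, rfl⟩
  have hclosed : IsClosed F := by
    have : F = ⋂ s ∈ S, {M : Matrix (Fin 3) (Fin 3) ℝ | normSq3 (M.mulVec s) ≤ 1} := by
      ext; simp [hF]
    rw [this]
    refine isClosed_biInter fun s _ ↦ isClosed_le (continuous_normSq3.comp ?_) continuous_const
    fun_prop
  -- The vectors `Pi.single j δ` in `S` bound each column of a feasible matrix.
  have hsub : F ⊆ Set.pi Set.univ fun _ ↦ Set.pi Set.univ fun _ ↦ Set.Icc (-(1 / δ)) (1 / δ) := by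
    intro M hM i _ j _
    rw [hF] at hM
    have h := hM _ (hSδ j)
    have hle : (M i j * δ) ^ 2 ≤ normSq3 (M.mulVec (Pi.single j δ)) := by
      simp only [Matrix.mulVec_single, normSq3]
      have := sq_nonneg (M 0 j * δ)
      have := sq_nonneg (M 1 j * δ)
      have := sq_nonneg (M 2 j * δ)
      fin_cases i <;> simp <;> linarith
    have := (sq_le_one_iff_abs_le_one _).1 (hle.trans h)
    rw [abs_mul, abs_of_pos hδ, ← le_div_iff₀ hδ] at this
    exact abs_le.1 this
  have hcompact : IsCompact F :=
    (isCompact_univ_pi fun _ ↦ isCompact_univ_pi fun _ ↦ isCompact_Icc).of_isClosed_subset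
      hclosed hsub
  obtain ⟨b, hb⟩ := hS.exists_bound_of_continuousOn continuous_normSq3.continuousOn
  obtain ⟨ε, hε, hε1, hεb⟩ := exists_pos_mul_le (abs_nonneg b) one_pos
  have hfeas : ε • (1 : Matrix (Fin 3) (Fin 3) ℝ) ∈ F := by
    rw [hF]
    intro s hs
    have h1 := (le_abs_self _).trans ((hb s hs).trans (le_abs_self b))
    have h2 : normSq3 ((ε • (1 : Matrix (Fin 3) (Fin 3) ℝ)).mulVec s) = ε ^ 2 * normSq3 s := by
      simp [normSq3, Matrix.smul_mulVec]; ring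
    rw [h2]
    have h3 : ε * (ε * normSq3 s) ≤ ε * (ε * |b|) := by gcongr
    have h4 : ε * (ε * |b|) ≤ 1 * (ε * |b|) := by gcongr
    nlinarith
  obtain ⟨M, hM, hmax⟩ := hcompact.exists_isMaxOn ⟨_, hfeas⟩
    (Continuous.matrix_det continuous_id).continuousOn
  have hpos : 0 < M.det := by
    refine lt_of_lt_of_le ?_ (hmax hfeas)
    simp [hε]
  rw [hF] at hM
  refine ⟨M, hpos, hM, fun R hR ↦ hmax (?_ : R ∈ F)⟩
  rw [hF]; exact hR

/-- A compact set spanning `ℝ³` has a linear image in the unit ball with three vectors whose squared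
determinant is at least `1 / 2`. -/
theorem exists_matrix_tripleDet {S : Set (Fin 3 → ℝ)} (hS : IsCompact S) {δ : ℝ}
    (hδ : 0 < δ) (hSδ : ∀ i, Pi.single i δ ∈ S) :
    ∃ M : Matrix (Fin 3) (Fin 3) ℝ, 0 < M.det ∧ (∀ s ∈ S, normSq3 (M.mulVec s) ≤ 1) ∧
      ∃ x ∈ S, ∃ y ∈ S, ∃ z ∈ S, 1 / 2 ≤ (M.det * tripleDet x y z) ^ 2 := by
  obtain ⟨M, hM, hM1, hmax⟩ := exists_max_det hS hδ hSδ
  refine ⟨M, hM, hM1, ?_⟩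
  have hS' : IsCompact (M.mulVec '' S) := hS.image (by fun_prop)
  obtain ⟨c, u, h0, hc, hI, hu, huS⟩ := exists_isotropic_of_maximal hS'
    -- Composition with `M` turns maximality of `M` for `S` into maximality of the identity for
    -- `M.mulVec '' S`.
    (by rintro _ ⟨s, hs, rfl⟩; exact hM1 s hs) (fun R hR ↦ by
      have := hmax (R * M) (fun s hs ↦ by
        rw [← Matrix.mulVec_mulVec]; exact hR _ ⟨s, hs, rfl⟩)
      rw [Matrix.det_mul] at this
      exact le_of_mul_le_mul_right (by linarith) hM)
  obtain ⟨i, j, k, h⟩ := exists_tripleDet_sq_ge h0 hc hI hu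
  obtain ⟨x, hx, hxu⟩ := huS i
  obtain ⟨y, hy, hyu⟩ := huS j
  obtain ⟨z, hz, hzu⟩ := huS k
  rw [← hxu, ← hyu, ← hzu, tripleDet_mulVec] at h
  exact ⟨x, hx, y, hy, z, hz, h⟩

/-! ### Volume bounds from segments and the volume of a simplex -/

open MeasureTheory in
theorem setLIntegral_one_sub_pow (n : ℕ) :
    ∫⁻ t in Set.Ioc (0 : ℝ) 1, ENNReal.ofReal ((1 - t) ^ n) = ENNReal.ofReal (1 / (n + 1)) := by
  rw [← ofReal_integral_eq_lintegral_ofReal]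
  · rw [← intervalIntegral.integral_of_le zero_le_one,
      intervalIntegral.integral_comp_sub_left (fun t ↦ t ^ n) 1]
    simp
  · exact (by fun_prop : Continuous fun t : ℝ ↦ (1 - t) ^ n).integrableOn_Ioc
  · refine (ae_restrict_iff' measurableSet_Ioc).2 (.of_forall fun t ht ↦ ?_)
    exact pow_nonneg (by linarith [ht.2]) n

open MeasureTheory in
theorem volume_eq_prod_cons {n : ℕ} (K : Set (Fin (n + 1) → ℝ)) :
    volume K = (volume.prod volume)
      {p : ℝ × (Fin n → ℝ) | (Fin.cons p.1 p.2 : Fin (n + 1) → ℝ) ∈ K} := by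
  have h := (volume_preserving_piFinSuccAbove (fun _ : Fin (n + 1) ↦ ℝ) 0).symm
  rw [← h.measure_preimage_equiv, Measure.volume_eq_prod]
  congr 1
  ext p
  simp [MeasurableEquiv.piFinSuccAbove]
  rfl

theorem inv_factorial_succ (n : ℕ) : ENNReal.ofReal (1 / (n + 1)) * ENNReal.ofReal (1 / n.factorial)
    = ENNReal.ofReal (1 / (n + 1).factorial) := by
  rw [← ENNReal.ofReal_mul (by positivity), Nat.factorial_succ]
  congr 1
  push_cast
  field_simp

open MeasureTheory in
/-- A convex body with a chord of length one in a coordinate direction has volume at least that of a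
cone of height one over its projection along this direction. -/
theorem volume_ge_of_chord {n : ℕ} {K : Set (Fin (n + 1) → ℝ)} (hK : IsCompact K)
    (hconv : Convex ℝ K) {a : Fin (n + 1) → ℝ} (ha : a ∈ K) (ha1 : a + Pi.single 0 1 ∈ K) :
    ENNReal.ofReal (1 / (n + 1)) * volume (Fin.tail '' K) ≤ volume K := by
  obtain ⟨K', hK'⟩ : ∃ K' : Set (ℝ × (Fin n → ℝ)),
    K' = {p | (Fin.cons p.1 p.2 : Fin (n + 1) → ℝ) ∈ K} := ⟨_, rfl⟩
  have hcont : Continuous fun p : ℝ × (Fin n → ℝ) ↦ (Fin.cons p.1 p.2 : Fin (n + 1) → ℝ) :=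
    Continuous.finCons continuous_fst continuous_snd
  have hmeas : MeasurableSet K' := by
    rw [hK']; exact (hK.isClosed.preimage hcont).measurableSet
  obtain ⟨C, hC⟩ := hK.isBounded.subset_closedBall 0
  have hfib (y : Fin n → ℝ) : (fun t : ℝ ↦ (t, y)) ⁻¹' K' ⊆ Set.Icc (-C) C := by
    intro t ht
    rw [hK'] at ht
    have h := hC ht
    rw [mem_closedBall_zero_iff] at h
    have := (norm_le_pi_norm _ (0 : Fin (n + 1))).trans h
    simpa [abs_le] using this
  have hfin (y : Fin n → ℝ) : volume ((fun t : ℝ ↦ (t, y)) ⁻¹' K') ≠ ⊤ :=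
    ((measure_mono (hfib y)).trans_lt (by simp)).ne
  have hm : Measurable fun y : Fin n → ℝ ↦ volume ((fun t : ℝ ↦ (t, y)) ⁻¹' K') :=
    measurable_measure_prodMk_right hmeas
  -- Averaging a point of `K` with the two ends of the chord gives two points of `K` differing by
  -- `t` in direction 0. So fibres over the projection contracted by `1 - t` towards the chord have
  -- length at least `t`, and the layer-cake formula integrates `(1 - t) ^ n`.
  have hchord {t : ℝ} (ht : t ∈ Set.Ioc (0 : ℝ) 1) :
      AffineMap.homothety (Fin.tail a) (1 - t) '' (Fin.tail '' K) ⊆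
        {y | t ≤ (volume ((fun t : ℝ ↦ (t, y)) ⁻¹' K')).toReal} := by
    rintro _ ⟨_, ⟨x, hx, rfl⟩, rfl⟩
    have h0 := hconv ha hx ht.1.le (sub_nonneg.2 ht.2) (by ring)
    have h1 := hconv ha1 hx ht.1.le (sub_nonneg.2 ht.2) (by ring)
    have hsub : Set.Icc (t * a 0 + (1 - t) * x 0) (t * a 0 + (1 - t) * x 0 + t) ⊆
        (fun s : ℝ ↦ (s, AffineMap.homothety (Fin.tail a) (1 - t) (Fin.tail x))) ⁻¹' K' := by
      intro s hs
      rw [hK']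
      change (Fin.cons s (AffineMap.homothety (Fin.tail a) (1 - t) (Fin.tail x)) :
        Fin (n + 1) → ℝ) ∈ K
      have h2 := hconv h0 h1 (a := (t * a 0 + (1 - t) * x 0 + t - s) / t)
        (b := (s - (t * a 0 + (1 - t) * x 0)) / t)
        (div_nonneg (by linarith [hs.2]) ht.1.le) (div_nonneg (by linarith [hs.1]) ht.1.le)
        (by have := ht.1.ne'; field_simp; ring)
      convert h2 using 1
      have := ht.1.ne'
      ext i
      refine Fin.cases ?_ (fun j ↦ ?_) i
      · simp; field_simp; ring
      · simp [AffineMap.homothety_apply, Fin.tail]; field_simp; ring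
    have := measure_mono (μ := volume) hsub
    rw [Real.volume_Icc, add_sub_cancel_left] at this
    exact (ENNReal.ofReal_le_iff_le_toReal (hfin _)).1 this
  rw [volume_eq_prod_cons, ← hK', Measure.prod_apply_symm hmeas]
  calc ENNReal.ofReal (1 / (n + 1)) * volume (Fin.tail '' K)
      = ∫⁻ t in Set.Ioc (0 : ℝ) 1, ENNReal.ofReal ((1 - t) ^ n) * volume (Fin.tail '' K) := by
        rw [lintegral_mul_const, setLIntegral_one_sub_pow]
        fun_prop
    _ ≤ ∫⁻ t in Set.Ioc (0 : ℝ) 1, volume {y : Fin n → ℝ |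
          t ≤ (volume ((fun t : ℝ ↦ (t, y)) ⁻¹' K')).toReal} := by
        refine setLIntegral_mono' measurableSet_Ioc fun t ht ↦ ?_
        refine le_trans (le_of_eq ?_) (measure_mono (hchord ht))
        rw [Measure.addHaar_image_homothety, Module.finrank_fin_fun,
          abs_of_nonneg (pow_nonneg (sub_nonneg.2 ht.2) n)]
    _ ≤ ∫⁻ t in Set.Ioi (0 : ℝ), volume {y : Fin n → ℝ |
          t ≤ (volume ((fun t : ℝ ↦ (t, y)) ⁻¹' K')).toReal} :=
        lintegral_mono_set Set.Ioc_subset_Ioi_self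
    _ = ∫⁻ y, ENNReal.ofReal (volume ((fun t : ℝ ↦ (t, y)) ⁻¹' K')).toReal :=
        (lintegral_eq_lintegral_meas_le _ (.of_forall fun _ ↦ ENNReal.toReal_nonneg)
          hm.ennreal_toReal.aemeasurable).symm
    _ = _ := by simp_rw [ENNReal.ofReal_toReal (hfin _)]

open MeasureTheory in
/-- A convex body containing a unit segment in every coordinate direction has at least the volume of
the standard simplex. -/
theorem inv_factorial_le_volume {n : ℕ} {K : Set (Fin n → ℝ)} (hK : IsCompact K)
    (hconv : Convex ℝ K) (hne : K.Nonempty) (hseg : ∀ i, ∃ a ∈ K, a + Pi.single i 1 ∈ K) :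
    ENNReal.ofReal (1 / n.factorial) ≤ volume K := by
  induction n with
  | zero =>
    have : K = Set.univ := Set.eq_univ_of_forall fun x ↦ by
      obtain ⟨y, hy⟩ := hne
      rwa [Subsingleton.elim x y]
    simp [this, volume_pi]
  | succ n ih =>
    obtain ⟨a, ha, ha1⟩ := hseg 0
    refine le_trans ?_ (volume_ge_of_chord hK hconv ha ha1)
    rw [← inv_factorial_succ]
    gcongr
    refine ih (hK.image (by unfold Fin.tail; fun_prop)) ?_ (hne.image _) fun i ↦ ?_
    · exact hconv.linear_image
        (LinearMap.funLeft ℝ ℝ (Fin.succ : Fin n → Fin (n + 1)))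
    · obtain ⟨b, hb, hb1⟩ := hseg i.succ
      refine ⟨Fin.tail b, ⟨b, hb, rfl⟩, ⟨_, hb1, ?_⟩⟩
      ext j
      simp [Fin.tail, Pi.single_apply]

/-- The corner simplex spanned by the origin and the standard basis. -/
def cornerSimplex (n : ℕ) : Set (Fin n → ℝ) := {x | (∀ i, 0 ≤ x i) ∧ ∑ i, x i ≤ 1}

theorem isClosed_cornerSimplex (n : ℕ) : IsClosed (cornerSimplex n) := by
  have h1 : IsClosed {x : Fin n → ℝ | 0 ≤ x} := isClosed_le continuous_const continuous_id
  have h2 : IsClosed {x : Fin n → ℝ | ∑ i, x i ≤ 1} := isClosed_le (by fun_prop) continuous_const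
  exact h1.inter h2

open MeasureTheory Pointwise in
theorem volume_cornerSimplex_le (n : ℕ) :
    volume (cornerSimplex n) ≤ ENNReal.ofReal (1 / n.factorial) := by
  induction n with
  | zero =>
    refine (measure_mono (Set.subset_univ _)).trans ?_
    simp [volume_pi]
  | succ n ih =>
    have hmeas : MeasurableSet {p : ℝ × (Fin n → ℝ) |
        (Fin.cons p.1 p.2 : Fin (n + 1) → ℝ) ∈ cornerSimplex (n + 1)} :=
      ((isClosed_cornerSimplex (n + 1)).preimage
        (Continuous.finCons continuous_fst continuous_snd)).measurableSet
    rw [volume_eq_prod_cons, Measure.prod_apply hmeas]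
    rw [← inv_factorial_succ]
    have key : ∀ᵐ t : ℝ, volume (Prod.mk t ⁻¹' {p : ℝ × (Fin n → ℝ) |
        (Fin.cons p.1 p.2 : Fin (n + 1) → ℝ) ∈ cornerSimplex (n + 1)}) ≤
        (Set.Ioc (0 : ℝ) 1).indicator
          (fun t ↦ ENNReal.ofReal ((1 - t) ^ n) * ENNReal.ofReal (1 / n.factorial)) t := by
      -- Height 0 lies outside the half-open interval and height 1 forbids dividing by `1 - t`; both
      -- are null.
      filter_upwards [Measure.ae_ne volume 0, Measure.ae_ne volume 1] with t ht0 ht1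
      by_cases ht : t ∈ Set.Ioc (0 : ℝ) 1
      · have h1t : 0 < 1 - t := by
          have := ht.2.lt_of_ne ht1
          linarith
        rw [Set.indicator_of_mem ht]
        have hsub : Prod.mk t ⁻¹' {p : ℝ × (Fin n → ℝ) |
            (Fin.cons p.1 p.2 : Fin (n + 1) → ℝ) ∈ cornerSimplex (n + 1)} ⊆
            (1 - t) • (cornerSimplex n) := by
          rintro y ⟨hy0, hy1⟩
          refine ⟨(1 - t)⁻¹ • y, ⟨fun i ↦ ?_, ?_⟩, ?_⟩
          · have := hy0 i.succ
            simp only [Fin.cons_succ] at this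
            simp only [Pi.smul_apply, smul_eq_mul]
            positivity
          · simp only [Fin.sum_univ_succ, Fin.cons_zero, Fin.cons_succ] at hy1
            simp only [Pi.smul_apply, smul_eq_mul, ← Finset.mul_sum]
            rw [inv_mul_le_one₀ h1t]
            linarith
          · simp [smul_smul, h1t.ne']
        refine (measure_mono hsub).trans ?_
        rw [Measure.addHaar_smul, Module.finrank_fin_fun, abs_of_pos (pow_pos h1t n)]
        gcongr
      · have : Prod.mk t ⁻¹' {p : ℝ × (Fin n → ℝ) |
            (Fin.cons p.1 p.2 : Fin (n + 1) → ℝ) ∈ cornerSimplex (n + 1)} = ∅ := by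
          refine Set.eq_empty_of_forall_notMem fun y hy ↦ ht ?_
          obtain ⟨hy0, hy1⟩ := hy
          have h0 := hy0 0
          simp only [Fin.cons_zero] at h0
          have hnn : 0 ≤ ∑ i : Fin n, y i := Finset.sum_nonneg fun i _ ↦ by
            simpa using hy0 i.succ
          simp only [Fin.sum_univ_succ, Fin.cons_zero, Fin.cons_succ] at hy1
          exact ⟨h0.lt_of_ne' ht0, by linarith⟩
        rw [this]
        simp
    refine (lintegral_mono_ae key).trans (le_of_eq ?_)
    rw [lintegral_indicator measurableSet_Ioc, lintegral_mul_const, setLIntegral_one_sub_pow]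
    fun_prop

open MeasureTheory in
theorem volume_image_mulVec {n : ℕ} (M : Matrix (Fin n) (Fin n) ℝ) (s : Set (Fin n → ℝ)) :
    volume (M.mulVec '' s) = ENNReal.ofReal |M.det| * volume s := by
  have := Measure.addHaar_image_linearMap (volume : Measure (Fin n → ℝ)) (Matrix.toLin' M) s
  rwa [LinearMap.det_toLin'] at this

open MeasureTheory in
/-- A convex body containing translates of `n` segments has at least the volume of the simplex spanned
by these segments. -/
theorem abs_det_div_factorial_le_volume {n : ℕ} {K : Set (Fin n → ℝ)} (hK : IsCompact K)
    (hconv : Convex ℝ K) (hne : K.Nonempty) (v : Fin n → Fin n → ℝ)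
    (hseg : ∀ i, ∃ a ∈ K, a + v i ∈ K) :
    ENNReal.ofReal (|(Matrix.of v).det| / n.factorial) ≤ volume K := by
  obtain ⟨B, hB⟩ : ∃ B : Matrix (Fin n) (Fin n) ℝ, B = (Matrix.of v).transpose := ⟨_, rfl⟩
  have hdet : (Matrix.of v).det = B.det := by rw [hB, Matrix.det_transpose]
  rw [hdet]
  by_cases h0 : B.det = 0
  · simp [h0]
  have hu : IsUnit B.det := isUnit_iff_ne_zero.2 h0
  have hcol (i : Fin n) : B⁻¹.mulVec (v i) = Pi.single i 1 := by
    have : v i = B.mulVec (Pi.single i 1) := by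
      rw [Matrix.mulVec_single_one, hB]; rfl
    rw [this, Matrix.mulVec_mulVec, Matrix.nonsing_inv_mul _ hu, Matrix.one_mulVec]
  -- The inverse of the matrix with columns `v i` sends the segments to unit coordinate segments.
  have h := inv_factorial_le_volume (K := B⁻¹.mulVec '' K) (hK.image (by fun_prop))
    (hconv.linear_image (Matrix.toLin' B⁻¹)) (hne.image _) (fun i ↦ by
      obtain ⟨a, ha, ha1⟩ := hseg i
      exact ⟨_, ⟨a, ha, rfl⟩, ⟨_, ha1, by rw [Matrix.mulVec_add, hcol]⟩⟩)
  rw [volume_image_mulVec] at h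
  calc ENNReal.ofReal (|B.det| / n.factorial)
      = ENNReal.ofReal |B.det| * ENNReal.ofReal (1 / n.factorial) := by
        rw [← ENNReal.ofReal_mul (abs_nonneg _), mul_one_div]
    _ ≤ ENNReal.ofReal |B.det| * (ENNReal.ofReal |B⁻¹.det| * volume K) := by gcongr
    _ = volume K := by
        rw [← mul_assoc, ← ENNReal.ofReal_mul (abs_nonneg _), ← abs_mul, ← Matrix.det_mul,
          Matrix.mul_nonsing_inv _ hu]
        simp

theorem convex_cornerSimplex (n : ℕ) : Convex ℝ (cornerSimplex n) := by
  intro x hx y hy a b ha hb hab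
  refine ⟨fun i ↦ ?_, ?_⟩
  · have := hx.1 i
    have := hy.1 i
    simp only [Pi.add_apply, Pi.smul_apply, smul_eq_mul]
    positivity
  · simp only [Pi.add_apply, Pi.smul_apply, smul_eq_mul, Finset.sum_add_distrib, ← Finset.mul_sum]
    nlinarith [mul_le_mul_of_nonneg_left hx.2 ha, mul_le_mul_of_nonneg_left hy.2 hb]

open MeasureTheory in
/-- The volume of a simplex in terms of its edge vectors at one vertex. -/
theorem volume_convexHull_range {n : ℕ} (w : Fin (n + 1) → Fin n → ℝ) :
    volume (convexHull ℝ (Set.range w)) =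
      ENNReal.ofReal (|(Matrix.of fun i ↦ w i.succ - w 0).det| / n.factorial) := by
  have hw (i) : w i ∈ convexHull ℝ (Set.range w) := subset_convexHull ℝ _ ⟨i, rfl⟩
  refine le_antisymm ?_ (abs_det_div_factorial_le_volume
    ((Set.finite_range w).isCompact_convexHull ℝ) (convex_convexHull ℝ _) ⟨_, hw 0⟩ _ fun i ↦
    ⟨w 0, hw 0, by simpa using hw i.succ⟩)
  obtain ⟨B, hB⟩ : ∃ B : Matrix (Fin n) (Fin n) ℝ,
    B = (Matrix.of fun i ↦ w i.succ - w 0).transpose := ⟨_, rfl⟩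
  have hdet : (Matrix.of fun i ↦ w i.succ - w 0).det = B.det := by rw [hB, Matrix.det_transpose]
  have hsub : convexHull ℝ (Set.range w) ⊆ (fun x ↦ w 0 + x) '' (B.mulVec '' cornerSimplex n) := by
    refine convexHull_min ?_
      (((convex_cornerSimplex n).linear_image (Matrix.toLin' B)).translate (w 0))
    rintro _ ⟨i, rfl⟩
    refine Fin.cases ?_ (fun j ↦ ?_) i
    · exact ⟨0, ⟨0, ⟨by simp, by simp⟩, by simp⟩, by simp⟩
    · refine ⟨w j.succ - w 0, ⟨Pi.single j 1, ⟨fun i ↦ ?_, by simp⟩, ?_⟩, by simp⟩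
      · by_cases h : i = j <;> simp [h]
      · rw [Matrix.mulVec_single_one, hB]; rfl
  refine (measure_mono hsub).trans ?_
  rw [Set.image_add_left, measure_preimage_add, volume_image_mulVec, hdet, ← mul_one_div,
    ENNReal.ofReal_mul (abs_nonneg _)]
  gcongr
  exact volume_cornerSimplex_le n

/-! ### Tetrahedra with bounded edges -/

theorem tripleDet_sq_le_mul (x y z : Fin 3 → ℝ) :
    tripleDet x y z ^ 2 ≤ normSq3 x * normSq3 y * normSq3 z := by
  have h1 : tripleDet x y z ^ 2 ≤ ((x 1 * y 2 - x 2 * y 1) ^ 2 + (x 2 * y 0 - x 0 * y 2) ^ 2 +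
      (x 0 * y 1 - x 1 * y 0) ^ 2) * normSq3 z := by
    rw [tripleDet_eq, normSq3]
    generalize x 1 * y 2 - x 2 * y 1 = a
    generalize x 2 * y 0 - x 0 * y 2 = b
    generalize x 0 * y 1 - x 1 * y 0 = c
    nlinarith [sq_nonneg (a * z 1 - b * z 0), sq_nonneg (a * z 2 - c * z 0),
      sq_nonneg (b * z 2 - c * z 1)]
  refine h1.trans (mul_le_mul_of_nonneg_right ?_ (by unfold normSq3; positivity))
  unfold normSq3
  nlinarith [sq_nonneg (x 0 * y 0 + x 1 * y 1 + x 2 * y 2)]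

/-- Among tetrahedra with bounded edge lengths, the regular one has the largest volume. -/
theorem tripleDet_sq_le_of_edges {a b c : Fin 3 → ℝ} {D : ℝ} (ha : normSq3 a ≤ D)
    (hb : normSq3 b ≤ D) (hc : normSq3 c ≤ D) (hab : normSq3 (a - b) ≤ D)
    (hac : normSq3 (a - c) ≤ D) (hbc : normSq3 (b - c) ≤ D) :
    2 * tripleDet a b c ^ 2 ≤ D ^ 3 := by
  -- These are twice the bimedians, joining midpoints of opposite edges of the tetrahedron `0, a, b,
  -- c`. By the parallelogram law, the squared lengths of any two sum to twice the sum of two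
  -- squared edges.
  have h := tripleDet_sq_le_mul (b + c - a) (a + c - b) (a + b - c)
  have e : tripleDet (b + c - a) (a + c - b) (a + b - c) ^ 2 = 16 * tripleDet a b c ^ 2 := by
    simp only [tripleDet_eq, Pi.add_apply, Pi.sub_apply]; ring
  have s1 : normSq3 (b + c - a) + normSq3 (a + c - b) ≤ 4 * D := by
    simp only [normSq3, Pi.add_apply, Pi.sub_apply] at *; linarith
  have s2 : normSq3 (b + c - a) + normSq3 (a + b - c) ≤ 4 * D := by
    simp only [normSq3, Pi.add_apply, Pi.sub_apply] at *; linarith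
  have s3 : normSq3 (a + c - b) + normSq3 (a + b - c) ≤ 4 * D := by
    simp only [normSq3, Pi.add_apply, Pi.sub_apply] at *; linarith
  have nn (x) : 0 ≤ normSq3 x := by unfold normSq3; positivity
  have p1 := nn (b + c - a)
  have p2 := nn (a + c - b)
  have p3 := nn (a + b - c)
  rw [e] at h
  generalize normSq3 (b + c - a) = X at *
  generalize normSq3 (a + c - b) = Y at *
  generalize normSq3 (a + b - c) = Z at *
  have hD : 0 ≤ D := (nn a).trans ha
  have k : (X + Y) * (X + Z) * (Y + Z) ≤ 4 * D * (4 * D) * (4 * D) := by gcongr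
  -- The hints give `8 * X * Y * Z ≤ (X + Y) * (X + Z) * (Y + Z) ≤ 64 * D ^ 3`.
  nlinarith [mul_nonneg p1 (sq_nonneg (Y - Z)), mul_nonneg p2 (sq_nonneg (X - Z)),
    mul_nonneg p3 (sq_nonneg (X - Y))]

/-! ### Transfer to Euclidean space and the theorem -/

theorem dist_eq_sqrt_normSq3 (x y : EuclideanSpace ℝ (Fin 3)) :
    dist x y = √(normSq3 (x.ofLp - y.ofLp)) := by
  rw [EuclideanSpace.dist_eq]
  simp [normSq3, Fin.sum_univ_three, Real.dist_eq]

open MeasureTheory in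
theorem volume_image_ofLp (s : Set (EuclideanSpace ℝ (Fin 3))) :
    volume ((fun x ↦ x.ofLp) '' s) = volume s := by
  have h := EuclideanSpace.volume_preserving_symm_measurableEquiv_toLp (Fin 3)
  rw [← h.symm.measure_preimage_equiv s]
  congr 1
  ext x
  constructor
  · rintro ⟨y, hy, rfl⟩
    exact hy
  · intro hx
    exact ⟨_, hx, rfl⟩

theorem exists_linearEquiv_ofLp {M : Matrix (Fin 3) (Fin 3) ℝ} (hM : M.det ≠ 0) :
    ∃ T : EuclideanSpace ℝ (Fin 3) ≃ₗ[ℝ] EuclideanSpace ℝ (Fin 3),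
      ∀ x, (T x).ofLp = M.mulVec x.ofLp := by
  refine ⟨(WithLp.linearEquiv 2 ℝ (Fin 3 → ℝ)).trans
    ((Matrix.toLin' M).equivOfDetNeZero (by rwa [LinearMap.det_toLin']) |>.trans
      (WithLp.linearEquiv 2 ℝ (Fin 3 → ℝ)).symm), fun x ↦ rfl⟩

open MeasureTheory in
/-- Every convex body in `ℝ³` has a linear image whose isodiametric quotient is at least that of the
regular simplex. -/
theorem exists_linearEquiv_volume_ge {K : Set (EuclideanSpace ℝ (Fin 3))} (hK : IsConvexBody3 K) :
    ∃ T : EuclideanSpace ℝ (Fin 3) ≃ₗ[ℝ] EuclideanSpace ℝ (Fin 3),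
      √2 / 12 * Metric.diam (T '' K) ^ 3 ≤ volume.real (T '' K) := by
  obtain ⟨hconv, hcomp, x₀, hx₀⟩ := hK
  obtain ⟨r, hr, hball⟩ := Metric.isOpen_iff.1 isOpen_interior x₀ hx₀
  obtain ⟨L, hL⟩ : ∃ L : Set (Fin 3 → ℝ), L = (fun x : EuclideanSpace ℝ (Fin 3) ↦ x.ofLp) '' K :=
    ⟨_, rfl⟩
  have hLcomp : IsCompact L := by rw [hL]; exact hcomp.image (by fun_prop)
  have hLconv : Convex ℝ L := by
    rw [hL]; exact hconv.linear_image (WithLp.linearEquiv 2 ℝ (Fin 3 → ℝ)).toLinearMap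
  have hx₀L : x₀.ofLp ∈ L := by rw [hL]; exact ⟨x₀, interior_subset hx₀, rfl⟩
  obtain ⟨S, hS⟩ : ∃ S : Set (Fin 3 → ℝ), S = (fun p : (Fin 3 → ℝ) × (Fin 3 → ℝ) ↦ p.1 - p.2) ''
    (L ×ˢ L) := ⟨_, rfl⟩
  have hScomp : IsCompact S := by rw [hS]; exact (hLcomp.prod hLcomp).image (by fun_prop)
  have hSδ (i : Fin 3) : Pi.single i (r / 2) ∈ S := by
    rw [hS]
    refine ⟨(x₀.ofLp + Pi.single i (r / 2), x₀.ofLp), ⟨?_, hx₀L⟩, by simp⟩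
    rw [hL]
    refine ⟨x₀ + EuclideanSpace.single i (r / 2), interior_subset (hball ?_), rfl⟩
    rw [Metric.mem_ball, dist_eq_norm]
    simp [abs_of_pos hr]
    linarith
  obtain ⟨M, hM, hM1, x, hx, y, hy, z, hz, hdet⟩ :=
    exists_matrix_tripleDet hScomp (half_pos hr) hSδ
  obtain ⟨T, hT⟩ := exists_linearEquiv_ofLp hM.ne'
  refine ⟨T, ?_⟩
  have hseg {x : Fin 3 → ℝ} (hx : x ∈ S) : ∃ a ∈ L, a + x ∈ L := by
    rw [hS] at hx
    obtain ⟨⟨p, q⟩, ⟨hp, hq⟩, rfl⟩ := hx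
    exact ⟨q, hq, by simpa using hp⟩
  have hdiam : Metric.diam (T '' K) ≤ 1 := by
    refine Metric.diam_le_of_forall_dist_le zero_le_one ?_
    rintro _ ⟨p, hp, rfl⟩ _ ⟨q, hq, rfl⟩
    rw [dist_eq_sqrt_normSq3, hT, hT, ← Matrix.mulVec_sub, Real.sqrt_le_one]
    apply hM1
    rw [hS, hL]
    exact ⟨(p.ofLp, q.ofLp), ⟨⟨p, hp, rfl⟩, ⟨q, hq, rfl⟩⟩, rfl⟩
  have hvolL := abs_det_div_factorial_le_volume hLcomp hLconv ⟨_, hx₀L⟩ ![x, y, z] (fun i ↦ by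
    fin_cases i
    · exact hseg hx
    · exact hseg hy
    · exact hseg hz)
  have hvol : volume (T '' K) = ENNReal.ofReal |M.det| * volume L := by
    rw [← volume_image_ofLp, ← volume_image_mulVec, hL, Set.image_image, Set.image_image]
    simp_rw [hT]
  have hfin : volume (T '' K) ≠ ⊤ := by
    rw [hvol]
    exact ENNReal.mul_ne_top ENNReal.ofReal_ne_top hLcomp.measure_lt_top.ne
  have hge : |M.det * tripleDet x y z| / 6 ≤ volume.real (T '' K) := by
    rw [Measure.real, ← ENNReal.ofReal_le_iff_le_toReal hfin, hvol, abs_mul, mul_div_assoc,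
      ENNReal.ofReal_mul (abs_nonneg _)]
    gcongr
    exact hvolL
  have hs : √2 / 2 ≤ |M.det * tripleDet x y z| := by
    refine abs_le_of_sq_le_sq' ?_ (abs_nonneg _) |>.2
    rw [sq_abs, div_pow, Real.sq_sqrt (by norm_num)]
    linarith
  calc √2 / 12 * Metric.diam (T '' K) ^ 3 ≤ √2 / 12 * 1 := by
        gcongr
        exact pow_le_one₀ Metric.diam_nonneg hdiam
    _ ≤ volume.real (T '' K) := by linarith

open MeasureTheory in
theorem volume_real_image_simplex (v : Fin 4 → EuclideanSpace ℝ (Fin 3))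
    (T : EuclideanSpace ℝ (Fin 3) ≃ₗ[ℝ] EuclideanSpace ℝ (Fin 3)) :
    volume.real (T '' convexHull ℝ (Set.range v)) =
      |tripleDet ((T (v 1)).ofLp - (T (v 0)).ofLp) ((T (v 2)).ofLp - (T (v 0)).ofLp)
        ((T (v 3)).ofLp - (T (v 0)).ofLp)| / 6 := by
  have e : (fun x : EuclideanSpace ℝ (Fin 3) ↦ x.ofLp) '' (T '' convexHull ℝ (Set.range v)) =
      convexHull ℝ (Set.range fun i ↦ (T (v i)).ofLp) := by
    have := LinearMap.image_convexHull (𝕜 := ℝ) ((WithLp.linearEquiv 2 ℝ (Fin 3 → ℝ)).toLinearMap ∘ₗ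
      T.toLinearMap) (Set.range v)
    rw [← Set.range_comp] at this
    rw [Set.image_image]
    exact this
  rw [Measure.real, ← volume_image_ofLp, e, volume_convexHull_range,
    ENNReal.toReal_ofReal (by positivity)]
  have : (Matrix.of fun i : Fin 3 ↦ (T (v i.succ)).ofLp - (T (v 0)).ofLp) =
      Matrix.of ![(T (v 1)).ofLp - (T (v 0)).ofLp, (T (v 2)).ofLp - (T (v 0)).ofLp,
        (T (v 3)).ofLp - (T (v 0)).ofLp] := by
    ext i j
    fin_cases i <;> rfl
  rw [this]
  simp [tripleDet, Nat.factorial]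

theorem diam_image_simplex (v : Fin 4 → EuclideanSpace ℝ (Fin 3))
    (T : EuclideanSpace ℝ (Fin 3) ≃ₗ[ℝ] EuclideanSpace ℝ (Fin 3)) :
    Metric.diam (T '' convexHull ℝ (Set.range v)) = Metric.diam (Set.range fun i ↦ T (v i)) := by
  have := LinearMap.image_convexHull (𝕜 := ℝ) T.toLinearMap (Set.range v)
  rw [← Set.range_comp] at this
  change T '' convexHull ℝ (Set.range v) = _ at this
  rw [this, convexHull_diam]
  rfl

open MeasureTheory in
theorem volume_simplex_le (v : Fin 4 → EuclideanSpace ℝ (Fin 3))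
    (T : EuclideanSpace ℝ (Fin 3) ≃ₗ[ℝ] EuclideanSpace ℝ (Fin 3)) :
    volume.real (T '' convexHull ℝ (Set.range v)) ≤
      √2 / 12 * Metric.diam (T '' convexHull ℝ (Set.range v)) ^ 3 := by
  rw [volume_real_image_simplex, diam_image_simplex]
  obtain ⟨d, hd⟩ : ∃ d, d = Metric.diam (Set.range fun i ↦ T (v i)) := ⟨_, rfl⟩
  rw [← hd]
  have hd0 : 0 ≤ d := by rw [hd]; exact Metric.diam_nonneg
  have hdist (i j) : normSq3 ((T (v i)).ofLp - (T (v j)).ofLp) ≤ d ^ 2 := by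
    have := Metric.dist_le_diam_of_mem (Set.finite_range fun i ↦ T (v i)).isBounded
      ⟨i, rfl⟩ ⟨j, rfl⟩
    rw [dist_eq_sqrt_normSq3, ← hd, Real.sqrt_le_left hd0] at this
    exact this
  have h := tripleDet_sq_le_of_edges (hdist 1 0) (hdist 2 0) (hdist 3 0)
    (by rw [sub_sub_sub_cancel_right]; exact hdist 1 2)
    (by rw [sub_sub_sub_cancel_right]; exact hdist 1 3)
    (by rw [sub_sub_sub_cancel_right]; exact hdist 2 3)
  have : |tripleDet ((T (v 1)).ofLp - (T (v 0)).ofLp) ((T (v 2)).ofLp - (T (v 0)).ofLp)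
        ((T (v 3)).ofLp - (T (v 0)).ofLp)| ≤ √2 / 2 * d ^ 3 := by
    refine abs_le_of_sq_le_sq ?_ (by positivity)
    rw [mul_pow, div_pow, Real.sq_sqrt (by norm_num)]
    nlinarith
  linarith

open MeasureTheory in
/-- Every simplex in `ℝ³` is a linear image of a translate of the regular one. -/
theorem exists_linearEquiv_simplex {v : Fin 4 → EuclideanSpace ℝ (Fin 3)}
    (hv : AffineIndependent ℝ v) :
    ∃ T : EuclideanSpace ℝ (Fin 3) ≃ₗ[ℝ] EuclideanSpace ℝ (Fin 3),
      √2 / 12 * Metric.diam (T '' convexHull ℝ (Set.range v)) ^ 3 ≤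
        volume.real (T '' convexHull ℝ (Set.range v)) := by
  obtain ⟨B, hB⟩ : ∃ B : Matrix (Fin 3) (Fin 3) ℝ,
    B = (Matrix.of fun i : Fin 3 ↦ (v i.succ - v 0).ofLp).transpose := ⟨_, rfl⟩
  have hBu : IsUnit B.det := by
    rw [hB, Matrix.det_transpose, ← Matrix.isUnit_iff_isUnit_det,
      ← Matrix.linearIndependent_rows_iff_isUnit]
    have h := (affineIndependent_iff_linearIndependent_vsub ℝ v 0).1 hv
    have h' := h.comp (fun i : Fin 3 ↦ (⟨i.succ, Fin.succ_ne_zero i⟩ : {x : Fin 4 // x ≠ 0}))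
      (fun i j hij ↦ by simpa using hij)
    exact h'.map' (WithLp.linearEquiv 2 ℝ (Fin 3 → ℝ)).toLinearMap (LinearEquiv.ker _)
  -- The columns of `G` with the origin form a regular tetrahedron of edge `√2` and volume `1/3`. `G
  -- * B⁻¹` sends the edges at `v 0` to them.
  obtain ⟨G, hG⟩ : ∃ G : Matrix (Fin 3) (Fin 3) ℝ, G = !![0, 1, 1; 1, 0, 1; 1, 1, 0] := ⟨_, rfl⟩
  have hGdet : G.det = 2 := by rw [hG, Matrix.det_fin_three]; simp; norm_num
  obtain ⟨T, hT⟩ := exists_linearEquiv_ofLp (M := G * B⁻¹) (by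
    rw [Matrix.det_mul, hGdet]
    exact mul_ne_zero two_ne_zero (Matrix.isUnit_nonsing_inv_det B hBu).ne_zero)
  have hedge (i : Fin 3) : (T (v i.succ)).ofLp - (T (v 0)).ofLp = fun j ↦ G j i := by
    have : (v i.succ).ofLp - (v 0).ofLp = B.mulVec (Pi.single i 1) := by
      rw [Matrix.mulVec_single_one, hB]; rfl
    rw [hT, hT, ← Matrix.mulVec_sub, this, Matrix.mulVec_mulVec, mul_assoc,
      Matrix.nonsing_inv_mul _ hBu, mul_one, Matrix.mulVec_single_one]
    rfl
  have h1 : (T (v 1)).ofLp - (T (v 0)).ofLp = ![0, 1, 1] := by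
    rw [show (1 : Fin 4) = Fin.succ 0 from rfl, hedge, hG]; ext j; fin_cases j <;> rfl
  have h2 : (T (v 2)).ofLp - (T (v 0)).ofLp = ![1, 0, 1] := by
    rw [show (2 : Fin 4) = Fin.succ 1 from rfl, hedge, hG]; ext j; fin_cases j <;> rfl
  have h3 : (T (v 3)).ofLp - (T (v 0)).ofLp = ![1, 1, 0] := by
    rw [show (3 : Fin 4) = Fin.succ 2 from rfl, hedge, hG]; ext j; fin_cases j <;> rfl
  have hdist (i j : Fin 4) : normSq3 ((T (v i)).ofLp - (T (v j)).ofLp) ≤ 2 := by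
    rw [← sub_sub_sub_cancel_right _ _ (T (v 0)).ofLp]
    fin_cases i <;> fin_cases j <;> simp [h1, h2, h3, normSq3] <;> norm_num
  refine ⟨T, ?_⟩
  have hdiam : Metric.diam (Set.range fun i ↦ T (v i)) ≤ √2 := by
    refine Metric.diam_le_of_forall_dist_le (by positivity) ?_
    rintro _ ⟨i, rfl⟩ _ ⟨j, rfl⟩
    rw [dist_eq_sqrt_normSq3]
    exact Real.sqrt_le_sqrt (hdist i j)
  rw [volume_real_image_simplex, diam_image_simplex, h1, h2, h3]
  have hd : |tripleDet ![0, 1, 1] ![1, 0, 1] ![1, 1, 0]| = 2 := by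
    rw [tripleDet_eq]; simp; norm_num
  rw [hd]
  calc √2 / 12 * Metric.diam (Set.range fun i ↦ T (v i)) ^ 3 ≤ √2 / 12 * √2 ^ 3 := by
        gcongr
    _ = (√2 ^ 2) ^ 2 / 12 := by ring
    _ ≤ 2 / 6 := by rw [Real.sq_sqrt (by norm_num)]; norm_num

theorem theorem1 :
    (∀ K : Set (EuclideanSpace ℝ (Fin 3)), IsConvexBody3 K →
      ∃ T : EuclideanSpace ℝ (Fin 3) ≃ₗ[ℝ] EuclideanSpace ℝ (Fin 3),
        MeasureTheory.volume.real (T '' K) ≥ Real.sqrt 2 / 12 * Metric.diam (T '' K) ^ 3) ∧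
    (∀ v : Fin 4 → EuclideanSpace ℝ (Fin 3), AffineIndependent ℝ v →
      (∃ T : EuclideanSpace ℝ (Fin 3) ≃ₗ[ℝ] EuclideanSpace ℝ (Fin 3),
        MeasureTheory.volume.real (T '' convexHull ℝ (Set.range v)) =
          Real.sqrt 2 / 12 * Metric.diam (T '' convexHull ℝ (Set.range v)) ^ 3) ∧
      (∀ T : EuclideanSpace ℝ (Fin 3) ≃ₗ[ℝ] EuclideanSpace ℝ (Fin 3),
        MeasureTheory.volume.real (T '' convexHull ℝ (Set.range v)) ≤
          Real.sqrt 2 / 12 * Metric.diam (T '' convexHull ℝ (Set.range v)) ^ 3)) := by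
  refine ⟨fun K hK ↦ exists_linearEquiv_volume_ge hK, fun v hv ↦ ⟨?_, volume_simplex_le v⟩⟩
  obtain ⟨T, hT⟩ := exists_linearEquiv_simplex hv
  exact ⟨T, le_antisymm (volume_simplex_le v T) hT⟩
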